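/- Let $d\ge 1$ be an integer. For an integer $b>d$ let $I(b,d,1)=\sum \frac1m$, the sum being over the integers $m>0$ in whose base-$b$ expansion the digit $d$ occurs exactly once (this series converges for every $b>d$). Then, for fixed $d$ and $b\to\infty$ through the integers, $I(b,d,1)-b\log b$ has an asymptotic expansion to all orders in inverse powers of $b$: there are real numbers $a_n(d)$, $n\ge1$, such that for every integer $N\ge 0$ $$I(b,d,1)=b\log b+\sum_{n=1}^{N}\frac{a_n(d)}{b^n}+O(b^{-N-1})\qquad(b\to\infty),$$ where the implied constant may depend on $d$ and $N$. The first five coefficients are $$a_1(d)=\frac{d+\frac12}{d^2},\qquad a_2(d)=-\frac{9d^2+8d+2}{6d^3(d+1)},$$ $$a_3(d)=\left(d+\tfrac12\right)\zeta(2)+\left(d+\tfrac12\right)\frac{2d^3+4d^2+4d+1}{2d^4(d+1)^2},$$ $$a_4(d)=-(2d+1)d\,\zeta(3)+\left(d+\tfrac12\right)\zeta(2)-\frac{60d^7+180d^6+350d^5+585d^4+597d^3+331d^2+96d+12}{60d^5(d+1)^3},$$ $$a_5(d)=3\left(d+\tfrac12\right)d^2\zeta(4)-\left(3d^2+3d+\tfrac56\right)\zeta(3)-\left(d+\tfrac12\right)\zeta(2)-\frac{12d^8-24d^7-216d^6-387d^5-339d^4-186d^3-72d^2-18d-2}{12d^6(d+1)^3},$$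 where $\zeta$ is the Riemann zeta function. -/

import Mathlib

open Filter Asymptotics

/-- The positive integers whose base-`b` expansion contains the digit `d` exactly `k` times
(`Nat.digits` has no leading zeros). -/
def irwinSet (b d k : ℕ) : Set ℕ :=
  {m : ℕ | 0 < m ∧ (Nat.digits b m).count d = k}

/-- The Irwin harmonic sum `I(b,d,k)`: the sum of the reciprocals of the positive integers having
exactly `k` occurrences of the digit `d` in base `b`. -/
noncomputable def irwinSum (b d k : ℕ) : ℝ :=
  ∑' m : irwinSet b d k, 1 / ((m : ℕ) : ℝ)

/-! Write m as a leading digit a followed by a word w of l digits, so that m = bˡ (a + 0.w). If a ≠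
d, the word must contain d exactly once; if a = d, it must avoid d. Summing 1/m over all words
therefore expresses I(b,d,1) through two linear functionals applied to x ↦ 1/(a + x). Each has total
mass b, so after division by b (`avoidMean`, `onceMean`) their difference `meanDiff` annihilates
constants.

Splitting off the first digit of a word gives functional equations linking E f with the values of E
on x ↦ f((a + x)/b) (`avoidMean_eq`, `onceMean_eq`, `meanDiff_eq`). Put G(y) = ψ(1 + y) + γ. The
multiplication formula `digammaSeries_multiplication` writes ∑ 1/(a + x), 0 < a < b, as log b - G(x)
+ b⁻¹ ∑ G((a + x)/b). Under `onceMean` the functional equation cancels all of this except log b and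
one `meanDiff` term, which gives `irwinSum_eq`: I = b log b - meanDiff G((d + x)/b) + b · meanDiff
1/(d + x).

The functional equation of `meanDiff` absorbs the factor b in the last term. It leaves 1/d,
functions of (d + x)/b, and b ∑ 1/(n + x) over db ≤ n < (d + 1)b. Functions of (d + x)/b are
expanded by Taylor's formula, and the zeta values are the Taylor coefficients of G. The sum over n
is expanded in Bernoulli polynomials by the asymptotics of ψ; its large part b log((d + 1)/d) does
not depend on x, so `meanDiff` kills it.

Only moments remain. On xᵐ the functional equations become a triangular recursion whose coefficients
are polynomials in b⁻¹ (power sums of digits). The m-th moment carries the factor 1 - b⁻ᵐ + b⁻ᵐ⁻¹, a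
unit among power series in b⁻¹ for m ≥ 1, so every moment has an expansion
(`exists_hasExp_of_recursion`) and its coefficients can be computed one after another. -/

/-- `f b` has the asymptotic expansion `∑ Aₙ b⁻ⁿ` to all orders as `b → ∞`. -/
def HasExp (f : ℕ → ℝ) (A : PowerSeries ℝ) : Prop :=
  ∀ N : ℕ, (fun b : ℕ => f b - (A.trunc N).eval ((b : ℝ)⁻¹)) =O[atTop]
    fun b : ℕ => ((b : ℝ)⁻¹) ^ N

/-! ### Algebra of asymptotic expansions in powers of b⁻¹. -/

namespace HasExp

open PowerSeries in
theorem trunc_eval (A : PowerSeries ℝ) (N : ℕ) (x : ℝ) :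
    (A.trunc N).eval x = ∑ n ∈ Finset.range N, A.coeff n * x ^ n := by
  simpa [Polynomial.eval₂_id] using PowerSeries.eval₂_trunc_eq_sum_range x (RingHom.id ℝ) N A

theorem isBigO_pow_inv {M N : ℕ} (h : N ≤ M) :
    (fun b : ℕ => ((b : ℝ)⁻¹) ^ M) =O[atTop] fun b : ℕ => ((b : ℝ)⁻¹) ^ N := by
  refine IsBigO.of_bound 1 (Eventually.of_forall fun b => ?_)
  rw [one_mul, Real.norm_of_nonneg (by positivity), Real.norm_of_nonneg (by positivity)]
  exact pow_le_pow_of_le_one (by positivity) (Nat.cast_inv_le_one b) h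

theorem isBigO_eval_one (p : Polynomial ℝ) :
    (fun b : ℕ => p.eval ((b : ℝ)⁻¹)) =O[atTop] fun _ : ℕ => (1 : ℝ) := by
  have h : Tendsto (fun b : ℕ => p.eval ((b : ℝ)⁻¹)) atTop (nhds (p.eval 0)) :=
    (p.continuous.tendsto 0).comp (tendsto_inv_atTop_nhds_zero_nat (𝕜 := ℝ))
  exact h.isBigO_one ℝ

theorem isBigO_eval_of_coeff {p : Polynomial ℝ} {N : ℕ} (h : ∀ n < N, p.coeff n = 0) :
    (fun b : ℕ => p.eval ((b : ℝ)⁻¹)) =O[atTop] fun b : ℕ => ((b : ℝ)⁻¹) ^ N := by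
  obtain ⟨q, rfl⟩ := Polynomial.X_pow_dvd_iff.2 h
  simpa using (isBigO_refl (fun b : ℕ => ((b : ℝ)⁻¹) ^ N) atTop).mul (isBigO_eval_one q)

theorem isBigO_one {f : ℕ → ℝ} {A : PowerSeries ℝ} (h : HasExp f A) :
    f =O[atTop] fun _ : ℕ => (1 : ℝ) := by
  simpa [PowerSeries.trunc_zero'] using h 0

theorem congr' {f g : ℕ → ℝ} {A : PowerSeries ℝ} (h : HasExp f A) (e : f =ᶠ[atTop] g) :
    HasExp g A := fun N =>
  (h N).congr' (e.mono fun b hb => by simp only [hb]) EventuallyEq.rfl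

theorem polynomial (p : Polynomial ℝ) : HasExp (fun b => p.eval ((b : ℝ)⁻¹)) (p : PowerSeries ℝ) := by
  intro N
  have := isBigO_eval_of_coeff (p := p - ((p : PowerSeries ℝ).trunc N)) (N := N) (by
    intro n hn
    simp [PowerSeries.coeff_trunc, hn])
  simpa using this

theorem const (c : ℝ) : HasExp (fun _ => c) (PowerSeries.C c) := by
  simpa using polynomial (Polynomial.C c)

theorem inv : HasExp (fun b => (b : ℝ)⁻¹) PowerSeries.X := by
  simpa using polynomial Polynomial.X

theorem add {f g : ℕ → ℝ} {A B : PowerSeries ℝ} (hf : HasExp f A) (hg : HasExp g B) :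
    HasExp (fun b => f b + g b) (A + B) := fun N =>
  ((hf N).add (hg N)).congr_left fun b => by simp only [map_add, Polynomial.eval_add]; ring

theorem trunc_mul_isBigO (A B : PowerSeries ℝ) (N : ℕ) :
    (fun b : ℕ => (A.trunc N).eval ((b : ℝ)⁻¹) * (B.trunc N).eval ((b : ℝ)⁻¹)
      - ((A * B).trunc N).eval ((b : ℝ)⁻¹)) =O[atTop] fun b : ℕ => ((b : ℝ)⁻¹) ^ N := by
  have := isBigO_eval_of_coeff (p := A.trunc N * B.trunc N - (A * B).trunc N) (N := N) (by
    intro n hn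
    rw [Polynomial.coeff_sub, PowerSeries.coeff_trunc, if_pos hn, Polynomial.coeff_mul,
      PowerSeries.coeff_mul, sub_eq_zero]
    refine Finset.sum_congr rfl fun p hp => ?_
    have := Finset.HasAntidiagonal.mem_antidiagonal.1 hp
    rw [PowerSeries.coeff_trunc, PowerSeries.coeff_trunc, if_pos (by omega), if_pos (by omega)])
  simpa using this

theorem mul {f g : ℕ → ℝ} {A B : PowerSeries ℝ} (hf : HasExp f A) (hg : HasExp g B) :
    HasExp (fun b => f b * g b) (A * B) := by
  intro N
  have h1 := (hf N).mul hg.isBigO_one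
  have h2 := (isBigO_eval_one (A.trunc N)).mul (hg N)
  simp only [mul_one, one_mul] at h1 h2
  exact ((h1.add h2).add (trunc_mul_isBigO A B N)).congr_left fun b => by ring

theorem const_mul {f : ℕ → ℝ} {A : PowerSeries ℝ} (hf : HasExp f A) (c : ℝ) :
    HasExp (fun b => c * f b) (PowerSeries.C c * A) := (const c).mul hf

theorem neg {f : ℕ → ℝ} {A : PowerSeries ℝ} (hf : HasExp f A) : HasExp (fun b => -f b) (-A) := by
  simpa using hf.const_mul (-1)

theorem sub {f g : ℕ → ℝ} {A B : PowerSeries ℝ} (hf : HasExp f A) (hg : HasExp g B) :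
    HasExp (fun b => f b - g b) (A - B) := by
  simpa [sub_eq_add_neg] using hf.add hg.neg

theorem pow {f : ℕ → ℝ} {A : PowerSeries ℝ} (hf : HasExp f A) (k : ℕ) :
    HasExp (fun b => f b ^ k) (A ^ k) := by
  induction k with
  | zero => simpa using const 1
  | succ k ih => simpa [pow_succ] using ih.mul hf

theorem sum {ι : Type*} {s : Finset ι} {f : ι → ℕ → ℝ} {A : ι → PowerSeries ℝ}
    (h : ∀ i ∈ s, HasExp (f i) (A i)) : HasExp (fun b => ∑ i ∈ s, f i b) (∑ i ∈ s, A i) := by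
  classical
  induction s using Finset.induction_on with
  | empty => simpa using const 0
  | insert i s hi ih =>
    simp only [Finset.sum_insert hi]
    exact (h i (by simp)).add (ih fun j hj => h j (by simp [hj]))

theorem tendsto {f : ℕ → ℝ} {A : PowerSeries ℝ} (hf : HasExp f A) :
    Tendsto f atTop (nhds (PowerSeries.constantCoeff A)) := by
  have h := (hf 1).trans_tendsto (by
    simpa using tendsto_inv_atTop_nhds_zero_nat (𝕜 := ℝ))
  simpa [trunc_eval] using h.add_const (PowerSeries.constantCoeff A)

/-- Division of expansions: f - F_N = (h - F_N g)/g, where F_N g agrees with the truncation of F G =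
H up to O(b⁻ᴺ), and 1/g stays bounded because g has a nonzero limit. -/
theorem of_mul_eq {f g h : ℕ → ℝ} {F G H : PowerSeries ℝ} (hg : HasExp g G) (hh : HasExp h H)
    (e : ∀ᶠ b in atTop, f b * g b = h b) (hG : PowerSeries.constantCoeff G ≠ 0)
    (hF : F * G = H) : HasExp f F := by
  intro N
  have hne : ∀ᶠ b in atTop, g b ≠ 0 := hg.tendsto.eventually_ne hG
  have hinv : (fun b => (g b)⁻¹) =O[atTop] fun _ : ℕ => (1 : ℝ) :=
    (hg.tendsto.inv₀ hG).isBigO_one ℝ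
  have h2 := (isBigO_eval_one (F.trunc N)).mul (hg N)
  simp only [one_mul] at h2
  have h3 := ((hh N).sub ((h2.add (trunc_mul_isBigO F G N)))).mul hinv
  simp only [mul_one] at h3
  refine h3.congr' ?_ EventuallyEq.rfl
  filter_upwards [e, hne] with b hb hb'
  rw [hF, ← hb]
  field_simp
  ring

/-- In an expansion of zero, once the coefficients below n vanish, multiplying by bⁿ shows that the
constant coefficient n is O(b⁻¹), hence zero. -/
theorem unique {f : ℕ → ℝ} {A B : PowerSeries ℝ} (hA : HasExp f A) (hB : HasExp f B) : A = B := by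
  have h0 : ∀ (C : PowerSeries ℝ), HasExp (fun _ => 0) C → ∀ n, C.coeff n = 0 := by
    intro C hC n
    induction n using Nat.strong_induction_on with
    | _ n ih =>
    have h1 := hC (n + 1)
    have h2 : (fun b : ℕ => C.coeff n * ((b : ℝ)⁻¹) ^ n) =O[atTop]
        fun b : ℕ => ((b : ℝ)⁻¹) ^ (n + 1) := by
      refine h1.neg_left.congr_left fun b => ?_
      rw [trunc_eval, Finset.sum_range_succ, Finset.sum_eq_zero]
      · ring
      · intro i hi
        rw [ih i (Finset.mem_range.1 hi), zero_mul]
    have h3 : (fun b : ℕ => C.coeff n) =O[atTop] fun b : ℕ => ((b : ℝ)⁻¹) := by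
      have := h2.mul (isBigO_refl (fun b : ℕ => (b : ℝ) ^ n) atTop)
      refine this.congr' ?_ ?_ <;> filter_upwards [eventually_gt_atTop 0] with b hb
      · have : (b : ℝ) ≠ 0 := by positivity
        rw [inv_pow]
        field_simp
      · have : (b : ℝ) ≠ 0 := by positivity
        rw [pow_succ, inv_pow]
        field_simp
    have h4 := h3.trans_tendsto (tendsto_inv_atTop_nhds_zero_nat (𝕜 := ℝ))
    exact tendsto_nhds_unique tendsto_const_nhds h4
  have h := hA.sub hB
  simp only [sub_self] at h
  ext n
  simpa [sub_eq_zero] using h0 _ h n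

/-- An expansion in powers of `b⁻¹` whose coefficients have expansions themselves. -/
theorem series {f : ℕ → ℝ} {g : ℕ → ℕ → ℝ} {A : ℕ → PowerSeries ℝ} (hg : ∀ i, HasExp (g i) (A i))
    (h : ∀ N, (fun b : ℕ => f b - ∑ i ∈ Finset.range (N + 1), ((b : ℝ)⁻¹) ^ i * g i b) =O[atTop]
      fun b : ℕ => ((b : ℝ)⁻¹) ^ (N + 1)) :
    HasExp f (PowerSeries.mk fun n => ∑ i ∈ Finset.range (n + 1), (A i).coeff (n - i)) := by
  suffices key : ∀ N, (fun b : ℕ => f b - ((PowerSeries.mk fun n => ∑ i ∈ Finset.range (n + 1),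
      (A i).coeff (n - i)).trunc (N + 1)).eval ((b : ℝ)⁻¹)) =O[atTop]
      fun b : ℕ => ((b : ℝ)⁻¹) ^ (N + 1) by
    intro N
    -- The hypothesis starts at order one, so boundedness (order zero) is deduced from it
    -- separately.
    cases N with
    | zero =>
      have h1 := ((key 0).trans (isBigO_pow_inv (Nat.zero_le _))).add
        (by simpa using isBigO_eval_one (((PowerSeries.mk fun n => ∑ i ∈ Finset.range (n + 1),
          (A i).coeff (n - i)).trunc 1)))
      simpa [PowerSeries.trunc_zero'] using h1
    | succ N => exact key N
  intro N
  have h := h N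
  generalize N + 1 = N at h ⊢
  have h1 : HasExp (fun b => ∑ i ∈ Finset.range N, ((b : ℝ)⁻¹) ^ i * g i b)
      (∑ i ∈ Finset.range N, PowerSeries.X ^ i * A i) :=
    sum fun i _ => (inv.pow i).mul (hg i)
  refine (h.add (h1 N)).congr_left fun b => ?_
  have : (∑ i ∈ Finset.range N, PowerSeries.X ^ i * A i).trunc N
      = (PowerSeries.mk fun n => ∑ i ∈ Finset.range (n + 1), (A i).coeff (n - i)).trunc N := by
    ext n
    rw [PowerSeries.coeff_trunc, PowerSeries.coeff_trunc]
    split_ifs with hn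
    · rw [map_sum, PowerSeries.coeff_mk]
      simp only [PowerSeries.coeff_X_pow_mul']
      rw [← Finset.sum_filter]
      refine Finset.sum_congr ?_ fun _ _ => rfl
      ext i
      simp only [Finset.mem_filter, Finset.mem_range]
      omega
    · rfl
  rw [this]
  ring

end HasExp

/-! ### Weighted sums over words that avoid d or contain it once. -/

/-- Precomposition with the map `x ↦ (a + x) / b` which puts the digit `a` in front. -/
noncomputable def prependDigit (b a : ℕ) : (ℝ → ℝ) →ₗ[ℝ] (ℝ → ℝ) :=
  LinearMap.funLeft ℝ ℝ fun x => (a + x) * (b : ℝ)⁻¹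

theorem prependDigit_apply (b a : ℕ) (f : ℝ → ℝ) :
    prependDigit b a f = fun x => f ((a + x) * (b : ℝ)⁻¹) := rfl

/-- `b⁻ˡ ∑ f(0.w)`, the sum being over the words `w` of `l` digits without the digit `d`. -/
noncomputable def avoidSum (b d : ℕ) : ℕ → (ℝ → ℝ) →ₗ[ℝ] ℝ
  | 0 => LinearMap.proj 0
  | l + 1 => (b : ℝ)⁻¹ • ∑ a ∈ (Finset.range b).erase d, avoidSum b d l ∘ₗ prependDigit b a

/-- `b⁻ˡ ∑ f(0.w)`, the sum being over the words `w` of `l` digits with exactly one digit `d`. -/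
noncomputable def onceSum (b d : ℕ) : ℕ → (ℝ → ℝ) →ₗ[ℝ] ℝ
  | 0 => 0
  | l + 1 => (b : ℝ)⁻¹ • (∑ a ∈ (Finset.range b).erase d, onceSum b d l ∘ₗ prependDigit b a +
      avoidSum b d l ∘ₗ prependDigit b d)

theorem avoidSum_zero (b d : ℕ) (f : ℝ → ℝ) : avoidSum b d 0 f = f 0 := rfl

theorem avoidSum_succ (b d l : ℕ) (f : ℝ → ℝ) : avoidSum b d (l + 1) f =
    (b : ℝ)⁻¹ * ∑ a ∈ (Finset.range b).erase d, avoidSum b d l (prependDigit b a f) := by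
  simp [avoidSum]

theorem onceSum_zero (b d : ℕ) (f : ℝ → ℝ) : onceSum b d 0 f = 0 := rfl

theorem onceSum_succ (b d l : ℕ) (f : ℝ → ℝ) : onceSum b d (l + 1) f =
    (b : ℝ)⁻¹ * (∑ a ∈ (Finset.range b).erase d, onceSum b d l (prependDigit b a f) +
      avoidSum b d l (prependDigit b d f)) := by
  simp [onceSum, mul_add]

/-- The function `f` is bounded by `M` on the unit interval. -/
def BoundedBy (M : ℝ) (f : ℝ → ℝ) : Prop := ∀ x ∈ Set.Icc (0 : ℝ) 1, |f x| ≤ M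

theorem BoundedBy.nonneg {M : ℝ} {f : ℝ → ℝ} (h : BoundedBy M f) : 0 ≤ M :=
  (abs_nonneg _).trans (h 0 (by simp))

theorem BoundedBy.add {M N : ℝ} {f g : ℝ → ℝ} (hf : BoundedBy M f) (hg : BoundedBy N g) :
    BoundedBy (M + N) (f + g) := fun x hx =>
  (abs_add_le _ _).trans (add_le_add (hf x hx) (hg x hx))

theorem BoundedBy.smul {M : ℝ} {f : ℝ → ℝ} (hf : BoundedBy M f) (c : ℝ) :
    BoundedBy (|c| * M) (c • f) := fun x hx => by
  rw [Pi.smul_apply, smul_eq_mul, abs_mul]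
  exact mul_le_mul_of_nonneg_left (hf x hx) (abs_nonneg c)

theorem BoundedBy.neg {M : ℝ} {f : ℝ → ℝ} (hf : BoundedBy M f) : BoundedBy M (-f) :=
  fun x hx => (abs_neg (f x)).le.trans (hf x hx)

theorem BoundedBy.sub {M N : ℝ} {f g : ℝ → ℝ} (hf : BoundedBy M f) (hg : BoundedBy N g) :
    BoundedBy (M + N) (f - g) := by
  rw [sub_eq_add_neg]
  exact hf.add hg.neg

theorem prepend_mem {b a : ℕ} (h : a < b) {x : ℝ} (hx : x ∈ Set.Icc (0 : ℝ) 1) :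
    (a + x) * (b : ℝ)⁻¹ ∈ Set.Icc (0 : ℝ) 1 := by
  have h1 : (a : ℝ) + 1 ≤ b := by exact_mod_cast h
  have h0 : (0 : ℝ) ≤ a := a.cast_nonneg
  have := hx.1
  refine ⟨by positivity, ?_⟩
  rw [← div_eq_mul_inv, div_le_one (by linarith)]
  linarith [hx.2]

theorem BoundedBy.prependDigit {b a : ℕ} (h : a < b) {M : ℝ} {f : ℝ → ℝ} (hf : BoundedBy M f) :
    BoundedBy M (prependDigit b a f) := fun _ hx => hf _ (prepend_mem h hx)

section

variable {b d : ℕ}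

theorem abs_avoidSum_le (hd : d < b) (l : ℕ) {M : ℝ} {f : ℝ → ℝ} (hf : BoundedBy M f) :
    |avoidSum b d l f| ≤ M * ((b - 1) / b : ℝ) ^ l := by
  induction l generalizing f with
  | zero => simpa [avoidSum_zero] using hf 0 (by simp)
  | succ l ih =>
    rw [avoidSum_succ, abs_mul, abs_of_nonneg (by positivity)]
    have h1 : |∑ a ∈ (Finset.range b).erase d, avoidSum b d l (prependDigit b a f)| ≤
        ∑ a ∈ (Finset.range b).erase d, M * ((b - 1) / b : ℝ) ^ l :=
      (Finset.abs_sum_le_sum_abs _ _).trans (Finset.sum_le_sum fun a ha =>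
        ih (hf.prependDigit (Finset.mem_range.1 (Finset.mem_of_mem_erase ha))))
    rw [Finset.sum_const, Finset.card_erase_of_mem (Finset.mem_range.2 hd), Finset.card_range,
      nsmul_eq_mul, Nat.cast_pred (by omega)] at h1
    refine (mul_le_mul_of_nonneg_left h1 (by positivity)).trans (le_of_eq ?_)
    rw [pow_succ]
    ring

/-- There are l (b - 1)ˡ⁻¹ words of length l with exactly one d, each of weight b⁻ˡ. The form used
here avoids the exponent l - 1. -/
theorem abs_onceSum_le (hd : d < b) (hb : 2 ≤ b) (l : ℕ) {M : ℝ} {f : ℝ → ℝ}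
    (hf : BoundedBy M f) :
    |onceSum b d l f| ≤ M * (l * ((b - 1) / b : ℝ) ^ l / (b - 1)) := by
  have hb' : (2 : ℝ) ≤ b := by exact_mod_cast hb
  induction l generalizing f with
  | zero => simp [onceSum_zero]
  | succ l ih =>
    rw [onceSum_succ, abs_mul, abs_of_nonneg (by positivity)]
    have h1 : |∑ a ∈ (Finset.range b).erase d, onceSum b d l (prependDigit b a f)| ≤
        ∑ a ∈ (Finset.range b).erase d, M * (l * ((b - 1) / b : ℝ) ^ l / (b - 1)) :=
      (Finset.abs_sum_le_sum_abs _ _).trans (Finset.sum_le_sum fun a ha =>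
        ih (hf.prependDigit (Finset.mem_range.1 (Finset.mem_of_mem_erase ha))))
    rw [Finset.sum_const, Finset.card_erase_of_mem (Finset.mem_range.2 hd), Finset.card_range,
      nsmul_eq_mul, Nat.cast_pred (by omega)] at h1
    have h2 := abs_avoidSum_le hd l (hf.prependDigit hd)
    refine (mul_le_mul_of_nonneg_left ((abs_add_le _ _).trans (add_le_add h1 h2))
      (by positivity)).trans (le_of_eq ?_)
    have : (b : ℝ) - 1 ≠ 0 := by linarith
    rw [pow_succ]
    push_cast
    field_simp

theorem avoidSum_one (hd : d < b) (l : ℕ) : avoidSum b d l 1 = ((b - 1) / b : ℝ) ^ l := by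
  induction l with
  | zero => simp [avoidSum_zero]
  | succ l ih =>
    have h : ∀ a, prependDigit b a 1 = 1 := fun a => rfl
    simp only [avoidSum_succ, h, ih]
    rw [Finset.sum_const, Finset.card_erase_of_mem (Finset.mem_range.2 hd), Finset.card_range,
      nsmul_eq_mul, Nat.cast_pred (by omega), pow_succ]
    ring

theorem onceSum_one (hd : d < b) (hb : 2 ≤ b) (l : ℕ) :
    onceSum b d l 1 = l * ((b - 1) / b : ℝ) ^ l / (b - 1) := by
  have hb' : (2 : ℝ) ≤ b := by exact_mod_cast hb
  induction l with
  | zero => simp [onceSum_zero]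
  | succ l ih =>
    have h : ∀ a, prependDigit b a 1 = 1 := fun a => rfl
    simp only [onceSum_succ, h, ih, avoidSum_one hd]
    rw [Finset.sum_const, Finset.card_erase_of_mem (Finset.mem_range.2 hd), Finset.card_range,
      nsmul_eq_mul, Nat.cast_pred (by omega), pow_succ]
    have : (b : ℝ) - 1 ≠ 0 := by linarith
    push_cast
    field_simp

theorem digitRatio_mem (hb : 2 ≤ b) : ((b - 1) / b : ℝ) ∈ Set.Ioo (0 : ℝ) 1 := by
  have hb' : (2 : ℝ) ≤ b := by exact_mod_cast hb
  refine ⟨div_pos (by linarith) (by linarith), ?_⟩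
  rw [div_lt_one (by linarith)]
  linarith

theorem hasSum_avoid_mass (hb : 2 ≤ b) :
    HasSum (fun l : ℕ => ((b - 1) / b : ℝ) ^ l) (b : ℝ) := by
  have h := hasSum_geometric_of_lt_one (digitRatio_mem hb).1.le (digitRatio_mem hb).2
  have hb' : (b : ℝ) ≠ 0 := by positivity
  convert h using 1
  field_simp
  ring

/-- The total mass is b, the same as for the words that avoid d; this coincidence gives `meanDiff`
mass zero. -/
theorem hasSum_once_mass (hb : 2 ≤ b) :
    HasSum (fun l : ℕ => l * ((b - 1) / b : ℝ) ^ l / (b - 1)) (b : ℝ) := by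
  have h := hasSum_coe_mul_geometric_of_norm_lt_one (r := ((b - 1) / b : ℝ)) (by
    rw [Real.norm_of_nonneg (digitRatio_mem hb).1.le]
    exact (digitRatio_mem hb).2)
  have hb' : (2 : ℝ) ≤ b := by exact_mod_cast hb
  have h1 : (b : ℝ) - 1 ≠ 0 := by linarith
  have h2 : 1 - ((b : ℝ) - 1) / b = 1 / b := by field_simp; ring
  have h3 : ((b : ℝ) - 1) / b / (1 - (b - 1) / b) ^ 2 / (b - 1) = b := by
    rw [h2]
    field_simp
  have h4 := h.div_const ((b : ℝ) - 1)
  rwa [h3] at h4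

theorem summable_avoidSum (hd : d < b) (hb : 2 ≤ b) {M : ℝ} {f : ℝ → ℝ} (hf : BoundedBy M f) :
    Summable fun l => avoidSum b d l f :=
  Summable.of_norm_bounded ((hasSum_avoid_mass hb).summable.mul_left M)
    fun l => abs_avoidSum_le hd l hf

theorem summable_onceSum (hd : d < b) (hb : 2 ≤ b) {M : ℝ} {f : ℝ → ℝ} (hf : BoundedBy M f) :
    Summable fun l => onceSum b d l f :=
  Summable.of_norm_bounded ((hasSum_once_mass hb).summable.mul_left M)
    fun l => abs_onceSum_le hd hb l hf

end

/-! ### Normalised functionals and their functional equations. -/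

/-- The mean over all words without the digit `d`, normalized to have total mass one. -/
noncomputable def avoidMean (b d : ℕ) (f : ℝ → ℝ) : ℝ := (b : ℝ)⁻¹ * ∑' l, avoidSum b d l f

/-- The mean over all words with one digit `d`, normalized to have total mass one. -/
noncomputable def onceMean (b d : ℕ) (f : ℝ → ℝ) : ℝ := (b : ℝ)⁻¹ * ∑' l, onceSum b d l f

/-- The difference of `avoidMean` and `onceMean`. -/
noncomputable def meanDiff (b d : ℕ) (f : ℝ → ℝ) : ℝ := avoidMean b d f - onceMean b d f

/-- A linear functional of norm at most `C` on the functions bounded on the unit interval. -/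
structure BoundedFunctional (C : ℝ) (E : (ℝ → ℝ) → ℝ) : Prop where
  map_add : ∀ {f g : ℝ → ℝ} {M N : ℝ}, BoundedBy M f → BoundedBy N g → E (f + g) = E f + E g
  map_smul : ∀ (c : ℝ) (f : ℝ → ℝ), E (c • f) = c * E f
  le : ∀ {f : ℝ → ℝ} {M : ℝ}, BoundedBy M f → |E f| ≤ C * M

namespace BoundedFunctional

variable {C C' : ℝ} {E E' : (ℝ → ℝ) → ℝ}

theorem map_sub (hE : BoundedFunctional C E) {f g : ℝ → ℝ} {M N : ℝ} (hf : BoundedBy M f)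
    (hg : BoundedBy N g) : E (f - g) = E f - E g := by
  have : f - g = f + (-1 : ℝ) • g := by simp [sub_eq_add_neg]
  rw [this, hE.map_add hf (hg.smul _), hE.map_smul]
  ring

theorem map_sum' (hE : BoundedFunctional C E) {ι : Type*} (s : Finset ι) (f : ι → ℝ → ℝ)
    (hf : ∀ i ∈ s, ∃ M, BoundedBy M (f i)) :
    E (∑ i ∈ s, f i) = ∑ i ∈ s, E (f i) ∧ ∃ M, BoundedBy M (∑ i ∈ s, f i) := by
  classical
  induction s using Finset.induction_on with
  | empty =>
    refine ⟨?_, 0, fun x _ => by simp⟩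
    simpa using hE.map_smul 0 0
  | insert i s hi ih =>
    obtain ⟨h1, M, h2⟩ := ih fun j hj => hf j (Finset.mem_insert_of_mem hj)
    obtain ⟨N, h3⟩ := hf i (Finset.mem_insert_self _ _)
    rw [Finset.sum_insert hi, Finset.sum_insert hi, hE.map_add h3 h2, h1]
    exact ⟨rfl, _, h3.add h2⟩

theorem map_sum (hE : BoundedFunctional C E) {ι : Type*} {s : Finset ι} {f : ι → ℝ → ℝ}
    (hf : ∀ i ∈ s, ∃ M, BoundedBy M (f i)) : E (∑ i ∈ s, f i) = ∑ i ∈ s, E (f i) :=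
  (hE.map_sum' s f hf).1

theorem abs_sub_le (hE : BoundedFunctional C E) {f g : ℝ → ℝ} {M N : ℝ} (hg : BoundedBy N g)
    (h : BoundedBy M (f - g)) : |E f - E g| ≤ C * M := by
  have hf : BoundedBy (M + N) f := by simpa using h.add hg
  rw [← hE.map_sub hf hg]
  exact hE.le h

theorem congr (hE : BoundedFunctional C E) {f g : ℝ → ℝ} {N : ℝ} (hg : BoundedBy N g)
    (h : ∀ x ∈ Set.Icc (0 : ℝ) 1, f x = g x) : E f = E g := by
  have h1 : |E f - E g| ≤ C * 0 := hE.abs_sub_le hg fun x hx => by simp [h x hx]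
  rw [mul_zero] at h1
  exact sub_eq_zero.1 (abs_nonpos_iff.1 h1)

theorem sub (hE : BoundedFunctional C E) (hE' : BoundedFunctional C' E') :
    BoundedFunctional (C + C') fun f => E f - E' f where
  map_add hf hg := by simp only [hE.map_add hf hg, hE'.map_add hf hg]; ring
  map_smul c f := by simp only [hE.map_smul, hE'.map_smul]; ring
  le hf := (abs_sub _ _).trans (by linarith [hE.le hf, hE'.le hf])

end BoundedFunctional

theorem exists_boundedBy_of_continuousOn {f : ℝ → ℝ} (hf : ContinuousOn f (Set.Icc 0 1)) :
    ∃ M, BoundedBy M f :=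
  isCompact_Icc.exists_bound_of_continuousOn hf

section

variable {b d : ℕ}

theorem avoidMean_boundedFunctional (hd : d < b) (hb : 2 ≤ b) :
    BoundedFunctional 1 (avoidMean b d) where
  map_add hf hg := by
    simp only [avoidMean, _root_.map_add]
    rw [(summable_avoidSum hd hb hf).tsum_add (summable_avoidSum hd hb hg), mul_add]
  map_smul c f := by
    simp only [avoidMean, _root_.map_smul, smul_eq_mul, tsum_mul_left]
    ring
  le {f M} hf := by
    have h : |∑' l, avoidSum b d l f| ≤ M * b := by
      rw [← Real.norm_eq_abs]
      exact tsum_of_norm_bounded ((hasSum_avoid_mass hb).mul_left M) fun l => abs_avoidSum_le hd l hf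
    have hb' : (b : ℝ) ≠ 0 := by positivity
    rw [avoidMean, abs_mul, abs_of_nonneg (by positivity), one_mul]
    refine (mul_le_mul_of_nonneg_left h (by positivity)).trans (le_of_eq ?_)
    field_simp

theorem onceMean_boundedFunctional (hd : d < b) (hb : 2 ≤ b) :
    BoundedFunctional 1 (onceMean b d) where
  map_add hf hg := by
    simp only [onceMean, _root_.map_add]
    rw [(summable_onceSum hd hb hf).tsum_add (summable_onceSum hd hb hg), mul_add]
  map_smul c f := by
    simp only [onceMean, _root_.map_smul, smul_eq_mul, tsum_mul_left]
    ring
  le {f M} hf := by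
    have h : |∑' l, onceSum b d l f| ≤ M * b := by
      rw [← Real.norm_eq_abs]
      exact tsum_of_norm_bounded ((hasSum_once_mass hb).mul_left M) fun l => abs_onceSum_le hd hb l hf
    have hb' : (b : ℝ) ≠ 0 := by positivity
    rw [onceMean, abs_mul, abs_of_nonneg (by positivity), one_mul]
    refine (mul_le_mul_of_nonneg_left h (by positivity)).trans (le_of_eq ?_)
    field_simp

theorem meanDiff_boundedFunctional (hd : d < b) (hb : 2 ≤ b) :
    BoundedFunctional (1 + 1) (meanDiff b d) :=
  (avoidMean_boundedFunctional hd hb).sub (onceMean_boundedFunctional hd hb)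

theorem avoidMean_one (hd : d < b) (hb : 2 ≤ b) : avoidMean b d 1 = 1 := by
  have hb' : (b : ℝ) ≠ 0 := by positivity
  simp only [avoidMean, avoidSum_one hd, (hasSum_avoid_mass hb).tsum_eq]
  field_simp

theorem onceMean_one (hd : d < b) (hb : 2 ≤ b) : onceMean b d 1 = 1 := by
  have hb' : (b : ℝ) ≠ 0 := by positivity
  simp only [onceMean, onceSum_one hd hb, (hasSum_once_mass hb).tsum_eq]
  field_simp

theorem meanDiff_one (hd : d < b) (hb : 2 ≤ b) : meanDiff b d 1 = 0 := by
  rw [meanDiff, avoidMean_one hd hb, onceMean_one hd hb, sub_self]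

/-- Split by the first digit: the empty word gives f 0, and the sum over digits other than d is
written as the sum over all digits minus the term of d, since only complete digit sums simplify
later. -/
theorem avoidMean_eq (hd : d < b) (hb : 2 ≤ b) {M : ℝ} {f : ℝ → ℝ} (hf : BoundedBy M f) :
    avoidMean b d f = (b : ℝ)⁻¹ * (f 0 + ∑ a ∈ Finset.range b, avoidMean b d (prependDigit b a f)
      - avoidMean b d (prependDigit b d f)) := by
  rw [← Finset.sum_erase_add _ _ (Finset.mem_range.2 hd), ← add_assoc, add_sub_cancel_right]
  conv_lhs => rw [avoidMean, (summable_avoidSum hd hb hf).tsum_eq_zero_add]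
  simp only [avoidSum_zero, avoidSum_succ, tsum_mul_left]
  rw [Summable.tsum_finsetSum fun a ha => summable_avoidSum hd hb
    (hf.prependDigit (Finset.mem_range.1 (Finset.mem_of_mem_erase ha)))]
  simp only [avoidMean, Finset.mul_sum]

/-- A word with one d starts with another digit and still has to contain d, or starts with d and
must avoid it afterwards. Completing the sum to all digits turns the term of d into a `meanDiff`. -/
theorem onceMean_eq (hd : d < b) (hb : 2 ≤ b) {M : ℝ} {f : ℝ → ℝ} (hf : BoundedBy M f) :
    onceMean b d f = (b : ℝ)⁻¹ * (∑ a ∈ Finset.range b, onceMean b d (prependDigit b a f)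
      + meanDiff b d (prependDigit b d f)) := by
  have h : ∀ a ∈ (Finset.range b).erase d, Summable fun l => onceSum b d l (prependDigit b a f) :=
    fun a ha => summable_onceSum hd hb
      (hf.prependDigit (Finset.mem_range.1 (Finset.mem_of_mem_erase ha)))
  rw [← Finset.sum_erase_add _ _ (Finset.mem_range.2 hd), meanDiff, add_assoc,
    add_sub_cancel]
  conv_lhs => rw [onceMean, (summable_onceSum hd hb hf).tsum_eq_zero_add]
  simp only [onceSum_zero, onceSum_succ, tsum_mul_left, zero_add]
  rw [Summable.tsum_add (summable_sum h) (summable_avoidSum hd hb (hf.prependDigit hd)),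
    Summable.tsum_finsetSum h]
  simp only [onceMean, avoidMean, Finset.mul_sum, mul_add]

theorem meanDiff_eq (hd : d < b) (hb : 2 ≤ b) {M : ℝ} {f : ℝ → ℝ} (hf : BoundedBy M f) :
    meanDiff b d f = (b : ℝ)⁻¹ * (f 0 + ∑ a ∈ Finset.range b, meanDiff b d (prependDigit b a f)
      - (meanDiff b d (prependDigit b d f) + avoidMean b d (prependDigit b d f))) := by
  rw [meanDiff, avoidMean_eq hd hb hf, onceMean_eq hd hb hf]
  simp only [meanDiff, Finset.sum_sub_distrib]
  ring

end

/-! ### The Irwin sum as a functional of x ↦ 1/(a + x). -/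

theorem sum_Ico_mul_block {M : Type*} [AddCommMonoid M] (F : ℕ → M) (u v K : ℕ) :
    ∑ m ∈ Finset.Ico (u * K) ((u + v) * K), F m =
      ∑ c ∈ Finset.range v, ∑ m ∈ Finset.Ico ((u + c) * K) ((u + c + 1) * K), F m := by
  induction v with
  | zero => simp
  | succ v ih =>
    rw [Finset.sum_range_succ, ← ih, Finset.sum_Ico_consecutive]
    · rfl
    · exact Nat.mul_le_mul_right _ (by omega)
    · exact Nat.mul_le_mul_right _ (by omega)

/-- The reciprocal of `m` if `m` has exactly one digit `d` in base `b`, and zero otherwise. -/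
noncomputable def irwinTerm (b d m : ℕ) : ℝ :=
  if (Nat.digits b m).count d = 1 then 1 / (m : ℝ) else 0

/-- The sum of `irwinTerm` over the numbers whose expansion is that of `n` followed by `l` digits. -/
noncomputable def extensionSum (b d l n : ℕ) : ℝ :=
  ∑ m ∈ Finset.Ico (n * b ^ l) ((n + 1) * b ^ l), irwinTerm b d m

section

variable {b d : ℕ}

theorem extensionSum_succ (l n : ℕ) :
    extensionSum b d (l + 1) n = ∑ c ∈ Finset.range b, extensionSum b d l (n * b + c) := by
  have := sum_Ico_mul_block (irwinTerm b d) (n * b) b (b ^ l)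
  rw [extensionSum, pow_succ', ← mul_assoc, ← mul_assoc, add_mul n, one_mul, this]
  rfl

theorem count_digits_mul_add (hb : 2 ≤ b) {n c : ℕ} (hn : 0 < n) (hc : c < b) :
    (Nat.digits b (n * b + c)).count d = (Nat.digits b n).count d + if c = d then 1 else 0 := by
  rw [add_comm, mul_comm, Nat.digits_add b (by omega) c n hc (Or.inr hn.ne'), List.count_cons]
  simp [beq_iff_eq]

theorem smul_prependDigit_inv (hb : b ≠ 0) (n c : ℕ) :
    (b : ℝ)⁻¹ • prependDigit b c (fun x => 1 / ((n : ℝ) + x)) =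
      fun x => 1 / (((n * b + c : ℕ) : ℝ) + x) := by
  have hb' : (b : ℝ) ≠ 0 := by positivity
  funext x
  simp only [Pi.smul_apply, prependDigit_apply, smul_eq_mul, one_div, ← mul_inv]
  congr 1
  push_cast
  field_simp
  ring

theorem inv_mul_map_prependDigit (hb : b ≠ 0) (φ : (ℝ → ℝ) →ₗ[ℝ] ℝ) (n c : ℕ) :
    (b : ℝ)⁻¹ * φ (prependDigit b c fun x => 1 / ((n : ℝ) + x)) =
      φ fun x => 1 / (((n * b + c : ℕ) : ℝ) + x) := by
  rw [← smul_eq_mul, ← map_smul, smul_prependDigit_inv hb]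

/-- Appending c to n corresponds to prepending c to the word of fractional digits, because b⁻¹/(n +
(c + x)/b) = 1/(nb + c + x). The number of digits d already in n decides whether the remaining word
must contain d once, avoid it, or cannot exist. -/
theorem extensionSum_eq (hd : d < b) (hb : 2 ≤ b) (l : ℕ) : ∀ n : ℕ, 0 < n →
    ((Nat.digits b n).count d = 0 →
      extensionSum b d l n = onceSum b d l fun x => 1 / ((n : ℝ) + x)) ∧
    ((Nat.digits b n).count d = 1 →
      extensionSum b d l n = avoidSum b d l fun x => 1 / ((n : ℝ) + x)) ∧
    (2 ≤ (Nat.digits b n).count d → extensionSum b d l n = 0) := by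
  induction l with
  | zero =>
    intro n hn
    simp only [extensionSum, pow_zero, mul_one, Nat.Ico_succ_singleton, Finset.sum_singleton,
      irwinTerm, onceSum_zero, avoidSum_zero, add_zero]
    refine ⟨fun h => by simp [h], fun h => by simp [h], fun h => if_neg (by omega)⟩
  | succ l ih =>
    intro n hn
    have hmem : ∀ c ∈ (Finset.range b).erase d, c < b ∧ c ≠ d := fun c hc =>
      ⟨Finset.mem_range.1 (Finset.mem_of_mem_erase hc), Finset.ne_of_mem_erase hc⟩
    have hpos : ∀ c, 0 < n * b + c := fun c => by positivity
    have hcount : ∀ c ∈ (Finset.range b).erase d,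
        (Nat.digits b (n * b + c)).count d = (Nat.digits b n).count d := fun c hc => by
      rw [count_digits_mul_add hb hn (hmem c hc).1, if_neg (hmem c hc).2, add_zero]
    have hcount' : (Nat.digits b (n * b + d)).count d = (Nat.digits b n).count d + 1 := by
      rw [count_digits_mul_add hb hn hd, if_pos rfl]
    rw [extensionSum_succ, ← Finset.sum_erase_add _ _ (Finset.mem_range.2 hd), onceSum_succ,
      avoidSum_succ, mul_add, Finset.mul_sum, Finset.mul_sum]
    simp only [inv_mul_map_prependDigit (show b ≠ 0 by omega)]
    refine ⟨fun h => ?_, fun h => ?_, fun h => ?_⟩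
    · rw [(ih _ (hpos d)).2.1 (by omega)]
      congr 1
      exact Finset.sum_congr rfl fun c hc => (ih _ (hpos c)).1 (by rw [hcount c hc, h])
    · rw [(ih _ (hpos d)).2.2 (by omega), add_zero]
      exact Finset.sum_congr rfl fun c hc => (ih _ (hpos c)).2.1 (by rw [hcount c hc, h])
    · rw [(ih _ (hpos d)).2.2 (by omega), add_zero]
      exact Finset.sum_eq_zero fun c hc => (ih _ (hpos c)).2.2 (by rw [hcount c hc]; exact h)

/-- The sum of `irwinTerm` over the numbers of `l + 1` digits. -/
theorem sum_irwinTerm_digits (h0 : 0 < d) (hd : d < b) (l : ℕ) :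
    ∑ m ∈ Finset.Ico (b ^ l) (b ^ (l + 1)), irwinTerm b d m =
      ∑ a ∈ (Finset.Ico 1 b).erase d, onceSum b d l (fun x => 1 / ((a : ℝ) + x)) +
        avoidSum b d l (fun x => 1 / ((d : ℝ) + x)) := by
  have h := sum_Ico_mul_block (irwinTerm b d) 1 (b - 1) (b ^ l)
  rw [one_mul, show 1 + (b - 1) = b by omega, ← pow_succ'] at h
  rw [h]
  have h1 : ∑ c ∈ Finset.range (b - 1),
      ∑ m ∈ Finset.Ico ((1 + c) * b ^ l) ((1 + c + 1) * b ^ l), irwinTerm b d m =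
      ∑ a ∈ Finset.Ico 1 b, extensionSum b d l a := by
    rw [Finset.sum_Ico_eq_sum_range]
    rfl
  have hdig : ∀ a, 0 < a → a < b → (Nat.digits b a).count d = if a = d then 1 else 0 := by
    intro a ha hab
    rw [Nat.digits_of_lt b a ha.ne' hab]
    by_cases h : a = d <;> simp [h]
  rw [h1, ← Finset.sum_erase_add _ _ (Finset.mem_Ico.2 ⟨h0, hd⟩),
    (extensionSum_eq hd (by omega) l d h0).2.1 (by rw [hdig d h0 hd, if_pos rfl])]
  congr 1
  refine Finset.sum_congr rfl fun a ha => ?_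
  have h2 := Finset.mem_Ico.1 (Finset.mem_of_mem_erase ha)
  exact (extensionSum_eq hd (by omega) l a h2.1).1
    (by rw [hdig a h2.1 h2.2, if_neg (Finset.ne_of_mem_erase ha)])

theorem boundedBy_inv {a : ℝ} (ha : 0 < a) : BoundedBy (1 / a) fun x => 1 / (a + x) := by
  intro x hx
  have := hx.1
  rw [abs_of_nonneg (by positivity)]
  exact one_div_le_one_div_of_le ha (by linarith)

theorem hasSum_irwin (h0 : 0 < d) (hd : d < b) :
    HasSum (fun m : irwinSet b d 1 => 1 / ((m : ℕ) : ℝ))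
      (b * (onceMean b d (∑ a ∈ Finset.Ico 1 b, fun x => 1 / ((a : ℝ) + x)) +
        meanDiff b d fun x => 1 / ((d : ℝ) + x))) := by
  have hb : 2 ≤ b := by omega
  have hb' : (b : ℝ) ≠ 0 := by positivity
  have hbd : ∀ a ∈ Finset.Ico 1 b, ∃ M, BoundedBy M fun x => 1 / ((a : ℝ) + x) := fun a ha =>
    ⟨_, boundedBy_inv (by exact_mod_cast (Finset.mem_Ico.1 ha).1)⟩
  have hbde : ∀ a ∈ (Finset.Ico 1 b).erase d, ∃ M, BoundedBy M fun x => 1 / ((a : ℝ) + x) :=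
    fun a ha => hbd a (Finset.mem_of_mem_erase ha)
  have hdb := boundedBy_inv (a := (d : ℝ)) (by exact_mod_cast h0)
  set S := b * (onceMean b d (∑ a ∈ Finset.Ico 1 b, fun x => 1 / ((a : ℝ) + x)) +
        meanDiff b d fun x => 1 / ((d : ℝ) + x)) with hS
  have hsum : HasSum (fun l => ∑ m ∈ Finset.Ico (b ^ l) (b ^ (l + 1)), irwinTerm b d m) S := by
    simp only [sum_irwinTerm_digits h0 hd]
    have h1 := hasSum_sum (s := (Finset.Ico 1 b).erase d)
      (f := fun (a l : ℕ) => onceSum b d l (fun x => 1 / ((a : ℝ) + x)))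
      fun a ha => (summable_onceSum hd hb (hbde a ha).choose_spec).hasSum
    have h2 := (summable_avoidSum hd hb hdb).hasSum
    convert h1.add h2 using 1
    -- The `onceMean` term for a = d, added to complete the sum, is subtracted again inside
    -- `meanDiff`.
    rw [hS, (onceMean_boundedFunctional hd hb).map_sum hbd,
      ← Finset.sum_erase_add _ _ (Finset.mem_Ico.2 ⟨h0, hd⟩), meanDiff]
    simp only [onceMean, avoidMean, ← Finset.mul_sum]
    field_simp
    ring
  have hpart : ∀ L, ∑ m ∈ Finset.range (b ^ L), irwinTerm b d m =
      ∑ l ∈ Finset.range L, ∑ m ∈ Finset.Ico (b ^ l) (b ^ (l + 1)), irwinTerm b d m := by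
    intro L
    induction L with
    | zero => simp [irwinTerm]
    | succ L ih =>
      rw [Finset.sum_range_succ, ← ih, Finset.sum_range_add_sum_Ico]
      exact Nat.pow_le_pow_right (by omega) (by omega)
  have hnn : ∀ m, 0 ≤ irwinTerm b d m := fun m => by
    rw [irwinTerm]
    split_ifs <;> positivity
  have hmono : Monotone fun n => ∑ m ∈ Finset.range n, irwinTerm b d m := fun i j hij =>
    Finset.sum_le_sum_of_subset_of_nonneg (Finset.range_mono hij) fun m _ _ => hnn m
  have hall : HasSum (irwinTerm b d) S := by
    rw [hasSum_iff_tendsto_nat_of_nonneg hnn]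
    -- The terms are nonnegative, so convergence of the partial sums along the powers of b is
    -- enough.
    refine (tendsto_iff_tendsto_subseq_of_monotone hmono
      (tendsto_pow_atTop_atTop_of_one_lt (show 1 < b by omega))).2 ?_
    refine hsum.tendsto_sum_nat.congr fun L => (hpart L).symm
  classical
  have hind : irwinTerm b d = (irwinSet b d 1).indicator fun m => 1 / (m : ℝ) := by
    funext m
    rw [Set.indicator_apply, irwinTerm]
    rcases Nat.eq_zero_or_pos m with rfl | hm
    · simp
    · simp [irwinSet, hm]
  rw [hind] at hall
  exact (hasSum_subtype_iff_indicator (f := fun m : ℕ => 1 / (m : ℝ))).2 hall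

end

/-! ### Bernoulli polynomials and the asymptotics of ψ(n + x). -/

theorem bernoulliFun_eq_sum (j : ℕ) (x : ℝ) : bernoulliFun j x =
    ∑ k ∈ Finset.range (j + 1), ((bernoulli (j - k) : ℝ) * j.choose k) * x ^ k := by
  simp [bernoulliFun, Polynomial.bernoulli_def, Polynomial.eval_finsetSum, Polynomial.map_sum]

theorem sum_choose_mul_bernoulliFun (m : ℕ) (x : ℝ) :
    ∑ k ∈ Finset.range (m + 1), ((m + 1).choose k : ℝ) * bernoulliFun k x = (m + 1) * x ^ m := by
  have h := congrArg (fun p => (p.map (algebraMap ℚ ℝ)).eval x) (Polynomial.sum_bernoulli m)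
  simp only [Polynomial.map_sum, Polynomial.eval_finsetSum, Polynomial.map_smul,
    Polynomial.eval_smul, Polynomial.map_monomial, Polynomial.eval_monomial] at h
  simpa [bernoulliFun] using h

/-- Up to the sign (-1)ⁱ, this compares the coefficients of n⁻⁽ⁱ⁺¹⁾ in ψ(n + 1 + x) - ψ(n + x) =
1/(n + x); the term 1/(i + 1) comes from log(1 + 1/n). -/
theorem inv_add_one_add_sum_bernoulliFun (i : ℕ) (x : ℝ) :
    1 / ((i : ℝ) + 1) + ∑ j ∈ Finset.range i, bernoulliFun (j + 1) x / (j + 1) * i.choose j =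
      x ^ i := by
  have h := sum_choose_mul_bernoulliFun i x
  have hi : (i : ℝ) + 1 ≠ 0 := by positivity
  rw [Finset.sum_range_succ'] at h
  simp only [bernoulliFun_zero, Nat.choose_zero_right, Nat.cast_one, mul_one] at h
  have h2 : ∑ j ∈ Finset.range i, bernoulliFun (j + 1) x / (j + 1) * i.choose j =
      (∑ j ∈ Finset.range i, ((i + 1).choose (j + 1) : ℝ) * bernoulliFun (j + 1) x) / (i + 1) := by
    rw [Finset.sum_div]
    refine Finset.sum_congr rfl fun j _ => ?_
    have h3 : ((i : ℝ) + 1) * i.choose j = (i + 1).choose (j + 1) * (j + 1) := by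
      exact_mod_cast Nat.add_one_mul_choose_eq i j
    have hj : (j : ℝ) + 1 ≠ 0 := by positivity
    field_simp
    linear_combination bernoulliFun (j + 1) x * h3
  rw [h2, ← add_div, div_eq_iff hi]
  linear_combination h

theorem alternating_mul_one_add_X :
    PowerSeries.mk (fun n => (-1 : ℝ) ^ n) * (1 + PowerSeries.X) = 1 := by
  ext n
  rw [mul_add, mul_one, map_add]
  cases n with
  | zero => simp
  | succ n => simp [PowerSeries.coeff_succ_mul_X, pow_succ, PowerSeries.coeff_one]

theorem alternating_pow (j : ℕ) : PowerSeries.mk (fun n => (-1 : ℝ) ^ n) ^ (j + 1) =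
    PowerSeries.mk fun n => (-1 : ℝ) ^ n * ((j + n).choose j : ℝ) := by
  have h : PowerSeries.mk (fun n => (-1 : ℝ) ^ n) =
      PowerSeries.rescale (-1 : ℝ) (PowerSeries.mk 1) := by
    ext n
    simp [PowerSeries.coeff_rescale]
  rw [h, ← map_pow, PowerSeries.mk_one_pow_eq_mk_choose_add]
  ext n
  simp [PowerSeries.coeff_rescale]

theorem HasExp.inv_add_one : HasExp (fun n => ((n : ℝ) + 1)⁻¹)
    (PowerSeries.X * PowerSeries.mk fun n => (-1 : ℝ) ^ n) := by
  refine HasExp.of_mul_eq (by simpa using (HasExp.const 1).add HasExp.inv) HasExp.inv ?_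
    (by simp) (by rw [mul_assoc, alternating_mul_one_add_X, mul_one])
  filter_upwards [eventually_gt_atTop 0] with n hn
  field_simp

theorem inv_add_one_pow_isBigO (j N : ℕ) :
    (fun n : ℕ => ((n : ℝ) + 1)⁻¹ ^ (j + 1) - ∑ i ∈ Finset.range N,
      ((-1 : ℝ) ^ (i + j) * (i.choose j : ℝ)) * (n : ℝ)⁻¹ ^ (i + 1)) =O[atTop]
      fun n : ℕ => (n : ℝ)⁻¹ ^ (N + 1) := by
  refine (HasExp.inv_add_one.pow (j + 1) (N + 1)).congr_left fun n => ?_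
  rw [HasExp.trunc_eval, Finset.sum_range_succ', mul_pow, alternating_pow]
  congr 1
  rw [PowerSeries.coeff_X_pow_mul', if_neg (by omega), zero_mul, add_zero]
  refine Finset.sum_congr rfl fun i _ => ?_
  congr 1
  rw [PowerSeries.coeff_X_pow_mul', PowerSeries.coeff_mk]
  split_ifs with h
  · obtain ⟨k, rfl⟩ := Nat.exists_eq_add_of_le (show j ≤ i by omega)
    rw [show j + k + 1 - (j + 1) = k by omega, show j + k + j = k + 2 * j by omega, pow_add,
      pow_mul]
    simp
  · rw [Nat.choose_eq_zero_of_lt (by omega)]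
    simp

theorem log_one_add_inv_isBigO (N : ℕ) :
    (fun n : ℕ => Real.log ((n : ℝ) + 1) - Real.log n - ∑ i ∈ Finset.range N,
      ((-1 : ℝ) ^ i / (i + 1)) * (n : ℝ)⁻¹ ^ (i + 1)) =O[atTop]
      fun n : ℕ => (n : ℝ)⁻¹ ^ (N + 1) := by
  -- The Taylor remainder of the logarithm has the factor 1/(1 - n⁻¹), which is at most 2 for n ≥ 2.
  refine IsBigO.of_bound 2 ?_
  filter_upwards [eventually_ge_atTop 2] with n hn
  have hn' : (2 : ℝ) ≤ n := by exact_mod_cast hn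
  have h0 : (0 : ℝ) ≤ (n : ℝ)⁻¹ := by positivity
  have h2 : (n : ℝ)⁻¹ ≤ 2⁻¹ := inv_anti₀ (by norm_num) hn'
  have habs : |(-(n : ℝ)⁻¹)| = (n : ℝ)⁻¹ := by rw [abs_neg, abs_of_nonneg h0]
  have h := Real.abs_log_sub_add_sum_range_le (x := -(n : ℝ)⁻¹) (by rw [habs]; linarith) N
  rw [habs] at h
  have hlog : Real.log ((n : ℝ) + 1) - Real.log n = Real.log (1 - -(n : ℝ)⁻¹) := by
    rw [← Real.log_div (by positivity) (by positivity)]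
    congr 1
    field_simp
    ring
  have hs : ∑ i ∈ Finset.range N, (-(n : ℝ)⁻¹) ^ (i + 1) / ((i : ℝ) + 1) =
      - ∑ i ∈ Finset.range N, ((-1 : ℝ) ^ i / (i + 1)) * (n : ℝ)⁻¹ ^ (i + 1) := by
    rw [← Finset.sum_neg_distrib]
    refine Finset.sum_congr rfl fun i _ => ?_
    rw [neg_pow, pow_succ (-1 : ℝ)]
    ring
  rw [hs] at h
  rw [hlog, Real.norm_eq_abs, Real.norm_of_nonneg (by positivity)]
  rw [show Real.log (1 - -(n : ℝ)⁻¹) - ∑ i ∈ Finset.range N, ((-1 : ℝ) ^ i / (i + 1)) *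
    (n : ℝ)⁻¹ ^ (i + 1) = -∑ i ∈ Finset.range N, ((-1 : ℝ) ^ i / (i + 1)) *
    (n : ℝ)⁻¹ ^ (i + 1) + Real.log (1 - -(n : ℝ)⁻¹) by ring]
  refine h.trans ?_
  rw [div_le_iff₀ (by linarith)]
  nlinarith [pow_nonneg h0 (N + 1)]

theorem inv_add_eq_geom {n : ℕ} (hn : 0 < n) {x : ℝ} (hx : 0 ≤ x) (N : ℕ) :
    1 / ((n : ℝ) + x) = ∑ i ∈ Finset.range N, ((-1) ^ i * x ^ i) * (n : ℝ)⁻¹ ^ (i + 1) +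
      (-1) ^ N * x ^ N * (n : ℝ)⁻¹ ^ N / (n + x) := by
  have hn' : (0 : ℝ) < n := by exact_mod_cast hn
  induction N with
  | zero => simp
  | succ N ih =>
    rw [ih, Finset.sum_range_succ, add_assoc]
    congr 1
    have : (n : ℝ) + x ≠ 0 := by positivity
    rw [pow_succ, pow_succ, pow_succ]
    field_simp
    ring

/-- The partial sum of the asymptotic expansion of `ψ(n + x)` as `n → ∞`. -/
noncomputable def digammaApprox (N n : ℕ) (x : ℝ) : ℝ :=
  Real.log n + ∑ j ∈ Finset.range N, (-1) ^ j * bernoulliFun (j + 1) x / (j + 1) *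
    (n : ℝ)⁻¹ ^ (j + 1)

/-- Expanding both sides in n⁻¹, the coefficients up to n⁻⁽ᴺ⁺¹⁾ agree by
`inv_add_one_add_sum_bernoulliFun`. The remainders are uniform in x because the Bernoulli
polynomials are bounded on the unit interval. -/
theorem digammaApprox_step (N : ℕ) : ∃ C : ℝ, ∀ᶠ n : ℕ in atTop, ∀ x ∈ Set.Icc (0 : ℝ) 1,
    |1 / ((n : ℝ) + x) - (digammaApprox N (n + 1) x - digammaApprox N n x)| ≤
      C * (n : ℝ)⁻¹ ^ (N + 2) := by
  obtain ⟨c, hc⟩ := (log_one_add_inv_isBigO (N + 1)).bound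
  choose e he using fun j => (inv_add_one_pow_isBigO j (N + 1)).bound
  choose M hM using fun j => exists_boundedBy_of_continuousOn
    (continuous_bernoulliFun (k := j + 1)).continuousOn
  refine ⟨1 + (c + ∑ j ∈ Finset.range N, M j * e j), ?_⟩
  have he' : ∀ᶠ n : ℕ in atTop, ∀ j ∈ Finset.range N, _ :=
    (Filter.eventually_all_finset (Finset.range N)).2 fun j _ => he j
  filter_upwards [hc, he', eventually_gt_atTop 0] with n h1 h2 hn x hx
  have hn' : (0 : ℝ) < n := by exact_mod_cast hn
  have hh : (0 : ℝ) ≤ (n : ℝ)⁻¹ ^ (N + 1 + 1) := by positivity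
  rw [Real.norm_eq_abs, Real.norm_of_nonneg hh] at h1
  set L := Real.log ((n : ℝ) + 1) - Real.log n - ∑ i ∈ Finset.range (N + 1),
      ((-1 : ℝ) ^ i / (i + 1)) * (n : ℝ)⁻¹ ^ (i + 1) with hL
  set R : ℕ → ℝ := fun j => ((n : ℝ) + 1)⁻¹ ^ (j + 1) - ∑ i ∈ Finset.range (N + 1),
      ((-1 : ℝ) ^ (i + j) * (i.choose j : ℝ)) * (n : ℝ)⁻¹ ^ (i + 1) with hR
  have h2' : ∀ j ∈ Finset.range N, |R j| ≤ e j * (n : ℝ)⁻¹ ^ (N + 1 + 1) := fun j hj => by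
    have := h2 j hj
    rwa [Real.norm_eq_abs, Real.norm_of_nonneg hh] at this
  have key : 1 / ((n : ℝ) + x) - (digammaApprox N (n + 1) x - digammaApprox N n x) =
      (-1) ^ (N + 1) * x ^ (N + 1) * (n : ℝ)⁻¹ ^ (N + 1) / (n + x) -
        (L + ∑ j ∈ Finset.range N, (-1) ^ j * bernoulliFun (j + 1) x / (j + 1) * R j) := by
    have e1 : ∑ j ∈ Finset.range N, (-1) ^ j * bernoulliFun (j + 1) x / (j + 1) * R j =
        ∑ j ∈ Finset.range N, (-1) ^ j * bernoulliFun (j + 1) x / (j + 1) *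
          ((n : ℝ) + 1)⁻¹ ^ (j + 1) - ∑ i ∈ Finset.range (N + 1), (∑ j ∈ Finset.range N,
          (-1) ^ i * (bernoulliFun (j + 1) x / (j + 1) * i.choose j)) * (n : ℝ)⁻¹ ^ (i + 1) := by
      simp only [hR, mul_sub, Finset.sum_sub_distrib, Finset.mul_sum, Finset.sum_mul]
      rw [Finset.sum_comm]
      congr 1
      refine Finset.sum_congr rfl fun i _ => Finset.sum_congr rfl fun j _ => ?_
      have : ((-1 : ℝ)) ^ j * (-1) ^ j = 1 := by rw [← mul_pow]; simp
      rw [pow_add]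
      linear_combination ((-1) ^ i * (bernoulliFun (j + 1) x / (j + 1) * i.choose j) *
        (n : ℝ)⁻¹ ^ (i + 1)) * this
    have e2 : ∑ i ∈ Finset.range (N + 1), ((-1) ^ i * x ^ i) * (n : ℝ)⁻¹ ^ (i + 1) =
        ∑ i ∈ Finset.range (N + 1), ((-1 : ℝ) ^ i / (i + 1)) * (n : ℝ)⁻¹ ^ (i + 1) +
        ∑ i ∈ Finset.range (N + 1), (∑ j ∈ Finset.range N,
          (-1) ^ i * (bernoulliFun (j + 1) x / (j + 1) * i.choose j)) * (n : ℝ)⁻¹ ^ (i + 1) -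
        ∑ i ∈ Finset.range N, (-1) ^ i * bernoulliFun (i + 1) x / (i + 1) *
          (n : ℝ)⁻¹ ^ (i + 1) := by
      -- For i < N the sum also contains the term j = i, which the subtracted `digammaApprox N n x`
      -- cancels; for i = N that term is absent from both.
      have e3 : ∀ i ≤ N, ∑ j ∈ Finset.range N, (-1) ^ i *
          (bernoulliFun (j + 1) x / (j + 1) * i.choose j) =
          (-1) ^ i * (x ^ i - 1 / (i + 1)) +
            if i < N then (-1) ^ i * bernoulliFun (i + 1) x / (i + 1) else 0 := by
        intro i hi
        rw [← Finset.mul_sum, ← inv_add_one_add_sum_bernoulliFun i x]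
        split_ifs with hlt
        · have : ∑ j ∈ Finset.range N, bernoulliFun (j + 1) x / (j + 1) * (i.choose j : ℝ) =
              ∑ j ∈ Finset.range (i + 1), bernoulliFun (j + 1) x / (j + 1) * i.choose j := by
            refine (Finset.sum_subset (Finset.range_mono hlt) fun j _ hj => ?_).symm
            rw [Nat.choose_eq_zero_of_lt (by simpa using hj)]
            simp
          rw [this, Finset.sum_range_succ, Nat.choose_self]
          push_cast
          ring
        · obtain rfl : i = N := by omega
          ring
      have e4 : ∑ i ∈ Finset.range N, (-1) ^ i * bernoulliFun (i + 1) x / (i + 1) *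
          (n : ℝ)⁻¹ ^ (i + 1) = ∑ i ∈ Finset.range (N + 1),
          (if i < N then (-1) ^ i * bernoulliFun (i + 1) x / (i + 1) else 0) *
          (n : ℝ)⁻¹ ^ (i + 1) := by
        rw [Finset.sum_range_succ, if_neg (lt_irrefl N), zero_mul, add_zero]
        exact Finset.sum_congr rfl fun i hi => by rw [if_pos (Finset.mem_range.1 hi)]
      rw [e4, ← Finset.sum_add_distrib, ← Finset.sum_sub_distrib]
      refine Finset.sum_congr rfl fun i hi => ?_
      rw [e3 i (Nat.lt_succ_iff.1 (Finset.mem_range.1 hi))]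
      ring
    rw [inv_add_eq_geom hn hx.1 (N + 1), e1, e2, hL, digammaApprox, digammaApprox]
    push_cast
    ring
  have b1 : |(-1) ^ (N + 1) * x ^ (N + 1) * (n : ℝ)⁻¹ ^ (N + 1) / (n + x)| ≤
      (n : ℝ)⁻¹ ^ (N + 1 + 1) := by
    have hx0 := hx.1
    rw [abs_div, abs_mul, abs_mul, abs_pow, abs_neg, abs_one, one_pow, one_mul,
      abs_of_nonneg (by positivity), abs_of_nonneg (by positivity), abs_of_pos (by positivity),
      pow_succ _ (N + 1), div_eq_mul_inv]
    refine mul_le_mul ?_ (inv_anti₀ hn' (by linarith)) (by positivity) (by positivity)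
    exact mul_le_of_le_one_left (by positivity) (pow_le_one₀ hx.1 hx.2)
  have b2 : |∑ j ∈ Finset.range N, (-1) ^ j * bernoulliFun (j + 1) x / (j + 1) * R j| ≤
      ∑ j ∈ Finset.range N, M j * e j * (n : ℝ)⁻¹ ^ (N + 1 + 1) := by
    refine (Finset.abs_sum_le_sum_abs _ _).trans (Finset.sum_le_sum fun j hj => ?_)
    rw [abs_mul, mul_assoc]
    refine mul_le_mul ?_ (h2' j hj) (abs_nonneg _) (hM j).nonneg
    rw [abs_div, abs_mul, abs_pow, abs_neg, abs_one, one_pow, one_mul,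
      abs_of_nonneg (by positivity : (0 : ℝ) ≤ (j : ℝ) + 1)]
    exact (div_le_self (abs_nonneg _) (by linarith [j.cast_nonneg (α := ℝ)])).trans (hM j x hx)
  rw [key]
  refine (abs_sub _ _).trans ((add_le_add b1 ((abs_add_le _ _).trans (add_le_add h1 b2))).trans
    (le_of_eq ?_))
  rw [← Finset.sum_mul]
  ring

/-- Telescoping `digammaApprox_step`; the errors satisfy ∑ n⁻⁽ᴺ⁺²⁾ ≤ A⁻ᴺ ∑ n⁻² ≤ 2 A⁻⁽ᴺ⁺¹⁾ for n ≥
A. -/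
theorem sum_inv_add_sub_digammaApprox (N : ℕ) : ∃ C : ℝ, ∀ᶠ A : ℕ in atTop, ∀ B ≥ A,
    ∀ x ∈ Set.Icc (0 : ℝ) 1,
    |∑ n ∈ Finset.Ico A B, 1 / ((n : ℝ) + x) - (digammaApprox N B x - digammaApprox N A x)| ≤
      C * (A : ℝ)⁻¹ ^ (N + 1) := by
  obtain ⟨C, hC⟩ := digammaApprox_step N
  obtain ⟨A₀, hA₀⟩ := eventually_atTop.1 hC
  refine ⟨|C| * 2, ?_⟩
  filter_upwards [eventually_ge_atTop A₀, eventually_gt_atTop 0] with A hA hA' B hB x hx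
  have hApos : (0 : ℝ) < A := by exact_mod_cast hA'
  rw [← Finset.sum_Ico_sub (fun n => digammaApprox N n x) hB, ← Finset.sum_sub_distrib]
  have h1 : ∀ n ∈ Finset.Ico A B,
      |1 / ((n : ℝ) + x) - (digammaApprox N (n + 1) x - digammaApprox N n x)| ≤
        |C| * (A : ℝ)⁻¹ ^ N * ((n : ℝ) ^ 2)⁻¹ := by
    intro n hn
    have hn' := Finset.mem_Ico.1 hn
    refine (hA₀ n (by omega) x hx).trans ?_
    rw [pow_add, ← inv_pow, ← mul_assoc]
    have h3 : (n : ℝ)⁻¹ ^ N ≤ (A : ℝ)⁻¹ ^ N := by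
      refine pow_le_pow_left₀ (by positivity) (inv_anti₀ hApos ?_) _
      exact_mod_cast hn'.1
    refine mul_le_mul_of_nonneg_right ?_ (by positivity)
    exact mul_le_mul (le_abs_self C) h3 (by positivity) (abs_nonneg C)
  refine ((Finset.abs_sum_le_sum_abs _ _).trans (Finset.sum_le_sum h1)).trans ?_
  rw [← Finset.mul_sum]
  have h2 : Finset.Ico A B = Finset.Ioo (A - 1) B := by
    ext n
    simp only [Finset.mem_Ico, Finset.mem_Ioo]
    omega
  have h3 := sum_Ioo_inv_sq_le (α := ℝ) (A - 1) B
  rw [← h2, Nat.cast_pred hA', sub_add_cancel] at h3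
  refine (mul_le_mul_of_nonneg_left h3 (by positivity)).trans (le_of_eq ?_)
  rw [pow_succ]
  ring

/-! ### Taylor expansion and multiplication formula of ψ(1 + y) + γ. -/

/-- The function `ψ(1 + y) + γ`. -/
noncomputable def digammaSeries (y : ℝ) : ℝ := ∑' k : ℕ, (1 / ((k : ℝ) + 1) - 1 / ((k : ℝ) + 1 + y))

theorem digammaSeries_term (k N : ℕ) {y : ℝ} (hy : 0 ≤ y) :
    1 / ((k : ℝ) + 1) - 1 / ((k : ℝ) + 1 + y) =
      ∑ i ∈ Finset.range N, (-1) ^ i * y ^ (i + 1) * (1 / ((k : ℝ) + 1) ^ (i + 2)) +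
        (-1) ^ N * y ^ (N + 1) / (((k : ℝ) + 1) ^ (N + 1) * (k + 1 + y)) := by
  have h := inv_add_eq_geom (Nat.succ_pos k) hy (N + 1)
  push_cast at h
  rw [h, Finset.sum_range_succ']
  have : ∑ i ∈ Finset.range N, (-1) ^ (i + 1) * y ^ (i + 1) * ((k : ℝ) + 1)⁻¹ ^ (i + 1 + 1) =
      -∑ i ∈ Finset.range N, (-1) ^ i * y ^ (i + 1) * (1 / ((k : ℝ) + 1) ^ (i + 2)) := by
    rw [← Finset.sum_neg_distrib]
    refine Finset.sum_congr rfl fun i _ => ?_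
    rw [inv_pow, pow_succ (-1 : ℝ), one_div]
    ring
  rw [this, pow_succ (-1 : ℝ) N]
  simp only [pow_zero, one_mul, zero_add, pow_one, inv_pow, mul_inv, div_eq_mul_inv]
  ring

theorem summable_zeta_tail {s : ℕ} (hs : 2 ≤ s) : Summable fun k : ℕ => 1 / ((k : ℝ) + 1) ^ s := by
  have := (summable_nat_add_iff 1).2 (Real.summable_one_div_nat_pow.2 (show 1 < s by omega))
  simpa using this

theorem riemannZeta_re_eq {s : ℕ} (hs : 2 ≤ s) :
    (riemannZeta s).re = ∑' k : ℕ, 1 / ((k : ℝ) + 1) ^ s := by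
  have h : riemannZeta s = ((∑' n : ℕ, 1 / (n : ℝ) ^ s : ℝ) : ℂ) := by
    rw [zeta_nat_eq_tsum_of_gt_one (by omega)]
    push_cast
    rfl
  rw [h, Complex.ofReal_re,
    (Real.summable_one_div_nat_pow.2 (show 1 < s by omega)).tsum_eq_zero_add]
  simp [show s ≠ 0 by omega]

theorem digammaSeries_remainder_le (k N : ℕ) {y : ℝ} (hy : 0 ≤ y) :
    ‖(-1) ^ N * y ^ (N + 1) / (((k : ℝ) + 1) ^ (N + 1) * (k + 1 + y))‖ ≤
      y ^ (N + 1) * (1 / ((k : ℝ) + 1) ^ 2) := by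
  have hk : (1 : ℝ) ≤ k + 1 := by linarith [k.cast_nonneg (α := ℝ)]
  rw [Real.norm_eq_abs, abs_div, abs_mul, abs_pow, abs_neg, abs_one, one_pow, one_mul,
    abs_of_nonneg (by positivity), abs_of_nonneg (by positivity), div_eq_mul_one_div]
  refine mul_le_mul_of_nonneg_left (one_div_le_one_div_of_le (by positivity) ?_) (by positivity)
  rw [sq]
  exact mul_le_mul (le_self_pow₀ hk (by omega)) (by linarith) (by positivity) (by positivity)

theorem summable_digammaSeries {y : ℝ} (hy : 0 ≤ y) :
    Summable fun k : ℕ => 1 / ((k : ℝ) + 1) - 1 / ((k : ℝ) + 1 + y) := by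
  refine Summable.of_norm_bounded ((summable_zeta_tail le_rfl).mul_left (y ^ (0 + 1))) fun k => ?_
  have h := digammaSeries_remainder_le k 0 hy
  rw [digammaSeries_term k 0 hy]
  simpa using h

/-- Each summand is a finite geometric expansion in y/(k + 1) with remainder at most yᴺ⁺¹/(k + 1)²;
summing over k gives zeta values and a remainder bounded by ζ(2) yᴺ⁺¹. -/
theorem digammaSeries_taylor (N : ℕ) {y : ℝ} (hy : 0 ≤ y) :
    |digammaSeries y - ∑ i ∈ Finset.range N, (-1) ^ i * (riemannZeta ((i + 2 : ℕ) : ℂ)).re *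
      y ^ (i + 1)| ≤ (riemannZeta ((2 : ℕ) : ℂ)).re * y ^ (N + 1) := by
  have h1 : HasSum (fun k : ℕ => (1 / ((k : ℝ) + 1) - 1 / ((k : ℝ) + 1 + y)) -
      ∑ i ∈ Finset.range N, (-1) ^ i * y ^ (i + 1) * (1 / ((k : ℝ) + 1) ^ (i + 2)))
      (digammaSeries y - ∑ i ∈ Finset.range N,
        (-1) ^ i * y ^ (i + 1) * (riemannZeta ((i + 2 : ℕ) : ℂ)).re) := by
    refine (summable_digammaSeries hy).hasSum.sub (hasSum_sum fun i _ => ?_)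
    rw [riemannZeta_re_eq (by omega)]
    exact (summable_zeta_tail (by omega)).hasSum.mul_left _
  have h2 : ∀ k : ℕ, ‖(1 / ((k : ℝ) + 1) - 1 / ((k : ℝ) + 1 + y)) -
      ∑ i ∈ Finset.range N, (-1) ^ i * y ^ (i + 1) * (1 / ((k : ℝ) + 1) ^ (i + 2))‖ ≤
      y ^ (N + 1) * (1 / ((k : ℝ) + 1) ^ 2) := fun k => by
    rw [digammaSeries_term k N hy, add_sub_cancel_left]
    exact digammaSeries_remainder_le k N hy
  have h3 := tsum_of_norm_bounded ((summable_zeta_tail le_rfl).hasSum.mul_left (y ^ (N + 1))) h2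
  rw [h1.tsum_eq, ← riemannZeta_re_eq le_rfl, Real.norm_eq_abs] at h3
  rw [mul_comm _ (y ^ (N + 1))]
  convert h3 using 4
  ring

theorem boundedBy_digammaSeries :
    BoundedBy (riemannZeta ((2 : ℕ) : ℂ)).re digammaSeries := fun x hx => by
  have h := digammaSeries_taylor 0 hx.1
  rw [Finset.sum_range_zero, sub_zero, zero_add, pow_one] at h
  refine h.trans (mul_le_of_le_one_right ?_ hx.2)
  rw [riemannZeta_re_eq le_rfl]
  exact tsum_nonneg fun k => by positivity

theorem tendsto_digammaSeries {y : ℝ} (hy : 0 ≤ y) :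
    Tendsto (fun M : ℕ => ∑ n ∈ Finset.Ico 1 M, (1 / (n : ℝ) - 1 / ((n : ℝ) + y))) atTop
      (nhds (digammaSeries y)) := by
  have h := (summable_digammaSeries hy).hasSum.tendsto_sum_nat.comp (tendsto_sub_atTop_nat 1)
  refine h.congr fun M => ?_
  rw [Finset.sum_Ico_eq_sum_range]
  refine Finset.sum_congr rfl fun k _ => ?_
  push_cast
  rw [add_comm (1 : ℝ)]

/-- Euler's constant cancels between the two harmonic sums, leaving log(Kb) - log K. -/
theorem tendsto_harmonic_mul_sub {b : ℕ} (hb : 0 < b) :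
    Tendsto (fun K : ℕ => ∑ n ∈ Finset.Ico 1 (K * b), 1 / (n : ℝ) -
      ∑ n ∈ Finset.Ico 1 K, 1 / (n : ℝ)) atTop (nhds (Real.log b)) := by
  have h1 : Tendsto (fun M : ℕ => ∑ n ∈ Finset.Ico 1 M, 1 / (n : ℝ) - Real.log M) atTop
      (nhds Real.eulerMascheroniConstant) := by
    have := Real.tendsto_harmonic_sub_log.sub (tendsto_inv_atTop_nhds_zero_nat (𝕜 := ℝ))
    rw [sub_zero] at this
    refine this.congr' ?_
    filter_upwards [eventually_gt_atTop 0] with M hM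
    obtain ⟨m, rfl⟩ := Nat.exists_eq_succ_of_ne_zero hM.ne'
    rw [harmonic_succ, harmonic, Finset.sum_Ico_eq_sum_range]
    push_cast
    simp only [one_div, add_comm (1 : ℝ)]
    ring
  have h2 := (h1.comp (tendsto_id.atTop_mul_const' hb)).sub h1
  rw [sub_self] at h2
  have h3 := h2.add_const (Real.log b)
  rw [zero_add] at h3
  refine h3.congr' ?_
  filter_upwards [eventually_gt_atTop 0] with K hK
  have : (K : ℝ) ≠ 0 := by positivity
  have : (b : ℝ) ≠ 0 := by positivity
  simp only [Function.comp, id]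
  push_cast
  rw [Real.log_mul (by assumption) (by assumption)]
  ring

/-- The multiplication formula of the digamma function. -/
theorem digammaSeries_multiplication {b : ℕ} (hb : 0 < b) {x : ℝ} (hx : 0 ≤ x) :
    digammaSeries x - (b : ℝ)⁻¹ * ∑ a ∈ Finset.range b, digammaSeries ((a + x) * (b : ℝ)⁻¹) =
      Real.log b - ∑ a ∈ Finset.Ico 1 b, 1 / ((a : ℝ) + x) := by
  have hb' : (b : ℝ) ≠ 0 := by positivity
  have h1 := ((tendsto_digammaSeries hx).comp (tendsto_id.atTop_mul_const' hb)).sub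
    ((tendsto_finsetSum (Finset.range b) fun a _ => tendsto_digammaSeries
      (show 0 ≤ ((a : ℝ) + x) * (b : ℝ)⁻¹ by positivity)).const_mul (b : ℝ)⁻¹)
  have h2 := (tendsto_harmonic_mul_sub hb).sub_const (∑ a ∈ Finset.Ico 1 b, 1 / ((a : ℝ) + x))
  refine tendsto_nhds_unique (h1.congr' ?_) h2
  filter_upwards [eventually_gt_atTop 0] with K hK
  -- The integers from b to Kb - 1 are sorted by residue modulo b: 1/(nb + a + x) = b⁻¹/(n + (a +
  -- x)/b).
  have h3 := sum_Ico_mul_block (fun m : ℕ => 1 / ((m : ℝ) + x)) 1 (K - 1) b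
  rw [one_mul, show 1 + (K - 1) = K by omega] at h3
  have h4 : ∑ m ∈ Finset.Ico b (K * b), 1 / ((m : ℝ) + x) =
      (b : ℝ)⁻¹ * ∑ a ∈ Finset.range b, ∑ n ∈ Finset.Ico 1 K,
        1 / ((n : ℝ) + (a + x) * (b : ℝ)⁻¹) := by
    rw [h3, Finset.sum_comm, Finset.sum_Ico_eq_sum_range, Finset.mul_sum]
    refine Finset.sum_congr rfl fun c _ => ?_
    rw [Finset.sum_Ico_eq_sum_range, Finset.mul_sum, add_mul (1 + c), one_mul,
      Nat.add_sub_cancel_left]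
    refine Finset.sum_congr rfl fun a _ => ?_
    rw [one_div, one_div, ← mul_inv]
    congr 1
    push_cast
    field_simp
    ring
  have h5 := Finset.sum_Ico_consecutive (fun m : ℕ => 1 / ((m : ℝ) + x)) (show 1 ≤ b by omega)
    (Nat.le_mul_of_pos_left b hK)
  simp only [Function.comp, id, Finset.sum_sub_distrib, mul_sub]
  rw [← h4, ← h5, Finset.sum_const, Finset.card_range, nsmul_eq_mul]
  field_simp
  ring

/-! ### Reduction of the Irwin sum to the functional of mass zero. -/

/-- The Irwin sum in terms of the measure `meanDiff` of total mass zero. -/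
theorem irwinSum_eq {b d : ℕ} (h0 : 0 < d) (hd : d < b) :
    irwinSum b d 1 = b * Real.log b - meanDiff b d (prependDigit b d digammaSeries) +
      b * meanDiff b d fun x => 1 / ((d : ℝ) + x) := by
  have hb : 2 ≤ b := by omega
  have hb' : (b : ℝ) ≠ 0 := by positivity
  have hE := onceMean_boundedFunctional hd hb
  have hG := boundedBy_digammaSeries
  have hone : BoundedBy 1 (1 : ℝ → ℝ) := fun x _ => by simp
  have hpre : ∀ a ∈ Finset.range b, ∃ M, BoundedBy M (prependDigit b a digammaSeries) :=
    fun a ha => ⟨_, hG.prependDigit (Finset.mem_range.1 ha)⟩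
  obtain ⟨e1, M, hM⟩ := hE.map_sum' (Finset.range b) _ hpre
  have h1 : onceMean b d (∑ a ∈ Finset.Ico 1 b, fun x => 1 / ((a : ℝ) + x)) =
      onceMean b d (Real.log b • (1 : ℝ → ℝ) - digammaSeries +
        (b : ℝ)⁻¹ • ∑ a ∈ Finset.range b, prependDigit b a digammaSeries) := by
    refine hE.congr (((hone.smul _).sub hG).add (hM.smul _)) fun x hx => ?_
    have := digammaSeries_multiplication (show 0 < b by omega) hx.1
    simp only [Finset.sum_apply, Pi.add_apply, Pi.sub_apply, Pi.smul_apply, Pi.one_apply,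
      smul_eq_mul, prependDigit_apply]
    linarith
  have h2 := onceMean_eq hd hb hG
  rw [irwinSum, (hasSum_irwin h0 hd).tsum_eq, h1,
    hE.map_add ((hone.smul (Real.log b)).sub hG) (hM.smul _),
    hE.map_sub (hone.smul _) hG, hE.map_smul, hE.map_smul, e1, onceMean_one hd hb]
  -- The functional equation at `digammaSeries` cancels the sum over all digits and leaves only the
  -- `meanDiff` term of d.
  rw [h2]
  field_simp
  ring

/-! ### Moments, their recursions and their expansions. -/

theorem exists_boundedBy_pow (c : ℝ) (i : ℕ) : ∃ M, BoundedBy M fun x => (c + x) ^ i :=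
  exists_boundedBy_of_continuousOn (by fun_prop)

theorem exists_boundedBy_pow' (i : ℕ) : ∃ M, BoundedBy M fun x => x ^ i :=
  exists_boundedBy_of_continuousOn (by fun_prop)

theorem BoundedFunctional.map_linear_comb {C : ℝ} {E : (ℝ → ℝ) → ℝ} (hE : BoundedFunctional C E)
    (n : ℕ) (c : ℕ → ℝ) (f : ℕ → ℝ → ℝ) (hf : ∀ i, ∃ M, BoundedBy M (f i)) :
    E (fun x => ∑ i ∈ Finset.range n, c i * f i x) = ∑ i ∈ Finset.range n, c i * E (f i) := by
  have h : (fun x => ∑ i ∈ Finset.range n, c i * f i x) =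
      ∑ i ∈ Finset.range n, c i • f i := by
    funext x
    simp
  rw [h, hE.map_sum fun i _ => ⟨_, (hf i).choose_spec.smul (c i)⟩]
  simp only [hE.map_smul]

theorem BoundedFunctional.map_shift_pow {C : ℝ} {E : (ℝ → ℝ) → ℝ} (hE : BoundedFunctional C E)
    (a : ℝ) (m : ℕ) : E (fun x => (a + x) ^ m) =
      ∑ i ∈ Finset.range (m + 1), ((m.choose i : ℝ) * a ^ (m - i)) * E fun x => x ^ i := by
  rw [← hE.map_linear_comb _ _ _ exists_boundedBy_pow']
  congr 1
  funext x
  rw [add_comm, add_pow]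
  exact Finset.sum_congr rfl fun i _ => by ring

theorem BoundedFunctional.map_prependDigit_pow {C : ℝ} {E : (ℝ → ℝ) → ℝ}
    (hE : BoundedFunctional C E) (b a m : ℕ) : E (prependDigit b a fun x => x ^ m) =
      (b : ℝ)⁻¹ ^ m * E fun x => (a + x) ^ m := by
  rw [← hE.map_smul]
  congr 1
  funext x
  simp only [prependDigit_apply, Pi.smul_apply, smul_eq_mul]
  rw [mul_pow, mul_comm]

/-- The polynomial `(∑_{a < b} aᵏ) / bᵏ⁺¹` in `b⁻¹`. -/
noncomputable def faulhaberPoly (k : ℕ) : Polynomial ℝ :=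
  ∑ r ∈ Finset.range (k + 1),
    Polynomial.C ((bernoulli r : ℝ) * (k + 1).choose r / (k + 1)) * Polynomial.X ^ r

theorem faulhaberPoly_zero : faulhaberPoly 0 = 1 := by
  simp [faulhaberPoly]

theorem faulhaberPoly_eval {b : ℕ} (hb : 0 < b) (k : ℕ) :
    (faulhaberPoly k).eval (b : ℝ)⁻¹ =
      (b : ℝ)⁻¹ ^ (k + 1) * ∑ a ∈ Finset.range b, (a : ℝ) ^ k := by
  have hb' : (b : ℝ) ≠ 0 := by positivity
  have h : ∑ a ∈ Finset.range b, (a : ℝ) ^ k = ∑ i ∈ Finset.range (k + 1),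
      (bernoulli i : ℝ) * (k + 1).choose i * (b : ℝ) ^ (k + 1 - i) / (k + 1) := by
    exact_mod_cast congrArg (Rat.cast : ℚ → ℝ) (sum_range_pow b k)
  rw [h, faulhaberPoly, Polynomial.eval_finsetSum, Finset.mul_sum]
  refine Finset.sum_congr rfl fun r hr => ?_
  have hr' : r ≤ k + 1 := by
    have := Finset.mem_range.1 hr
    omega
  have h2 : (b : ℝ)⁻¹ ^ r = (b : ℝ)⁻¹ ^ (k + 1) * (b : ℝ) ^ (k + 1 - r) := by
    have h3 : (b : ℝ)⁻¹ ^ (k + 1) = (b : ℝ)⁻¹ ^ r * (b : ℝ)⁻¹ ^ (k + 1 - r) := by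
      rw [← pow_add, Nat.add_sub_cancel' hr']
    rw [h3, mul_assoc, ← mul_pow, inv_mul_cancel₀ hb', one_pow, mul_one]
  simp only [Polynomial.eval_mul, Polynomial.eval_C, Polynomial.eval_pow, Polynomial.eval_X, h2]
  ring

/-- After the binomial expansion of (a + x)ᵐ, the digits enter only through power sums, which
Faulhaber's formula turns into polynomials in b⁻¹. -/
theorem BoundedFunctional.sum_map_prependDigit_pow {C : ℝ} {E : (ℝ → ℝ) → ℝ}
    (hE : BoundedFunctional C E) {b : ℕ} (hb : 0 < b) (m : ℕ) :
    (b : ℝ)⁻¹ * ∑ a ∈ Finset.range b, E (prependDigit b a fun x => x ^ m) =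
      ∑ i ∈ Finset.range (m + 1), (m.choose i : ℝ) *
        ((b : ℝ)⁻¹ ^ i * (faulhaberPoly (m - i)).eval (b : ℝ)⁻¹ * E fun x => x ^ i) := by
  simp only [hE.map_prependDigit_pow, hE.map_shift_pow, faulhaberPoly_eval hb, Finset.mul_sum,
    Finset.sum_mul]
  rw [Finset.sum_comm]
  refine Finset.sum_congr rfl fun i hi => Finset.sum_congr rfl fun a _ => ?_
  have h1 : (b : ℝ)⁻¹ ^ m = (b : ℝ)⁻¹ ^ i * (b : ℝ)⁻¹ ^ (m - i) := by
    rw [← pow_add, Nat.add_sub_cancel' (Nat.lt_succ_iff.1 (Finset.mem_range.1 hi))]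
  rw [h1, pow_succ]
  ring

/-- The moments of `avoidMean`. -/
noncomputable def avoidMoment (d m b : ℕ) : ℝ := avoidMean b d fun x => x ^ m

/-- The moments of `meanDiff`. -/
noncomputable def diffMoment (d m b : ℕ) : ℝ := meanDiff b d fun x => x ^ m

theorem avoidMoment_eq {b d : ℕ} (hd : d < b) (hb : 2 ≤ b) (m : ℕ) : avoidMoment d m b =
    ∑ i ∈ Finset.range (m + 1), (m.choose i : ℝ) *
      ((b : ℝ)⁻¹ ^ i * (faulhaberPoly (m - i)).eval (b : ℝ)⁻¹ * avoidMoment d i b) -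
    (b : ℝ)⁻¹ ^ (m + 1) * ∑ i ∈ Finset.range (m + 1),
      ((m.choose i : ℝ) * (d : ℝ) ^ (m - i)) * avoidMoment d i b + 0 ^ m * (b : ℝ)⁻¹ := by
  have hE := avoidMean_boundedFunctional hd hb
  rw [avoidMoment, avoidMean_eq hd hb (exists_boundedBy_pow' m).choose_spec, mul_sub, mul_add,
    hE.sum_map_prependDigit_pow (by omega), hE.map_prependDigit_pow, hE.map_shift_pow]
  simp only [avoidMoment]
  ring

theorem diffMoment_eq {b d : ℕ} (hd : d < b) (hb : 2 ≤ b) (m : ℕ) : diffMoment d m b =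
    ∑ i ∈ Finset.range (m + 1), (m.choose i : ℝ) *
      ((b : ℝ)⁻¹ ^ i * (faulhaberPoly (m - i)).eval (b : ℝ)⁻¹ * diffMoment d i b) -
    (b : ℝ)⁻¹ ^ (m + 1) * ∑ i ∈ Finset.range (m + 1),
      ((m.choose i : ℝ) * (d : ℝ) ^ (m - i)) * diffMoment d i b +
    (0 ^ m * (b : ℝ)⁻¹ - (b : ℝ)⁻¹ ^ (m + 1) * ∑ i ∈ Finset.range (m + 1),
      ((m.choose i : ℝ) * (d : ℝ) ^ (m - i)) * avoidMoment d i b) := by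
  have hE := meanDiff_boundedFunctional hd hb
  have hE' := avoidMean_boundedFunctional hd hb
  rw [diffMoment, meanDiff_eq hd hb (exists_boundedBy_pow' m).choose_spec, mul_sub, mul_add,
    hE.sum_map_prependDigit_pow (by omega), hE.map_prependDigit_pow, hE.map_shift_pow,
    hE'.map_prependDigit_pow, hE'.map_shift_pow]
  simp only [avoidMoment, diffMoment]
  ring

/-- Moving the two terms i = m to the left multiplies p m by 1 - b⁻ᵐ + b⁻ᵐ⁻¹, whose constant
coefficient is 1 for m ≥ 1. For m = 0 the factor is b⁻¹, so the total mass must be supplied as `h0`.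
Uniqueness of expansions then transfers the recursion to the power series. The inhomogeneity `q`
lets one statement serve both families of moments. -/
theorem exists_hasExp_of_recursion (c : ℝ) (p q : ℕ → ℕ → ℝ) (Q : ℕ → PowerSeries ℝ)
    (hq : ∀ m, HasExp (q m) (Q m)) (h0 : ∃ A, HasExp (p 0) A)
    (hp : ∀ m, ∀ᶠ b : ℕ in atTop, p m b = ∑ i ∈ Finset.range (m + 1), (m.choose i : ℝ) *
      ((b : ℝ)⁻¹ ^ i * (faulhaberPoly (m - i)).eval (b : ℝ)⁻¹ * p i b) -
      (b : ℝ)⁻¹ ^ (m + 1) * ∑ i ∈ Finset.range (m + 1),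
        ((m.choose i : ℝ) * c ^ (m - i)) * p i b + q m b) :
    ∃ P : ℕ → PowerSeries ℝ, (∀ m, HasExp (p m) (P m)) ∧
      ∀ m, P m = ∑ i ∈ Finset.range (m + 1), PowerSeries.C (m.choose i : ℝ) *
        (PowerSeries.X ^ i * (faulhaberPoly (m - i) : PowerSeries ℝ) * P i) -
        PowerSeries.X ^ (m + 1) * ∑ i ∈ Finset.range (m + 1),
          PowerSeries.C ((m.choose i : ℝ) * c ^ (m - i)) * P i + Q m := by
  have hex : ∀ m, ∃ A, HasExp (p m) A := by
    intro m
    induction m using Nat.strong_induction_on with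
    | _ m ih =>
    rcases Nat.eq_zero_or_pos m with rfl | hm
    · exact h0
    -- The default value 0 for i ≥ m makes the chosen family total.
    · have ih' : ∀ i, ∃ A, i ∈ Finset.range m → HasExp (p i) A := fun i => by
        by_cases hi : i < m
        · exact ⟨_, fun _ => (ih i hi).choose_spec⟩
        · exact ⟨0, fun h => absurd (Finset.mem_range.1 h) hi⟩
      choose P hP using ih'
      have hrhs := ((HasExp.sum (s := Finset.range m) fun i hi =>
        (((HasExp.inv.pow i).mul (HasExp.polynomial (faulhaberPoly (m - i)))).mul
          (hP i hi)).const_mul (m.choose i : ℝ)).sub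
        ((HasExp.inv.pow (m + 1)).mul (HasExp.sum (s := Finset.range m) fun i hi =>
          (hP i hi).const_mul ((m.choose i : ℝ) * c ^ (m - i))))).add (hq m)
      have hg := ((HasExp.const 1).sub (HasExp.inv.pow m)).add (HasExp.inv.pow (m + 1))
      have hG : PowerSeries.constantCoeff
          (PowerSeries.C (1 : ℝ) - PowerSeries.X ^ m + PowerSeries.X ^ (m + 1)) ≠ 0 := by
        simp [hm.ne']
      refine ⟨_, HasExp.of_mul_eq hg hrhs ?_ hG
        (by rw [mul_assoc, PowerSeries.inv_mul_cancel _ hG, mul_one])⟩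
      filter_upwards [hp m] with b hb
      rw [Finset.sum_range_succ, Finset.sum_range_succ, Nat.sub_self, faulhaberPoly_zero] at hb
      simp only [Nat.choose_self, Polynomial.eval_one, pow_zero] at hb
      push_cast at hb
      linear_combination hb
  choose P hP using hex
  refine ⟨P, hP, fun m => ?_⟩
  have hrhs := ((HasExp.sum (s := Finset.range (m + 1)) fun i _ =>
    (((HasExp.inv.pow i).mul (HasExp.polynomial (faulhaberPoly (m - i)))).mul
      (hP i)).const_mul (m.choose i : ℝ)).sub
    ((HasExp.inv.pow (m + 1)).mul (HasExp.sum (s := Finset.range (m + 1)) fun i _ =>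
      (hP i).const_mul ((m.choose i : ℝ) * c ^ (m - i))))).add (hq m)
  exact ((hP m).congr' (hp m)).unique hrhs

theorem eventually_base (d : ℕ) : ∀ᶠ b : ℕ in atTop, d < b ∧ 2 ≤ b :=
  (eventually_gt_atTop d).and (eventually_ge_atTop 2)

theorem avoidMoment_zero {b d : ℕ} (hd : d < b) (hb : 2 ≤ b) : avoidMoment d 0 b = 1 := by
  rw [← avoidMean_one hd hb, avoidMoment]
  simp only [pow_zero]
  rfl

theorem diffMoment_zero {b d : ℕ} (hd : d < b) (hb : 2 ≤ b) : diffMoment d 0 b = 0 := by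
  rw [← meanDiff_one hd hb, diffMoment]
  simp only [pow_zero]
  rfl

/-- The expansions of the moments, with the recursions which determine them. -/
theorem exists_moment_expansions (d : ℕ) : ∃ P D : ℕ → PowerSeries ℝ,
    (∀ m, HasExp (avoidMoment d m) (P m)) ∧ (∀ m, HasExp (diffMoment d m) (D m)) ∧
    P 0 = 1 ∧ D 0 = 0 ∧
    (∀ m, P m = ∑ i ∈ Finset.range (m + 1), PowerSeries.C (m.choose i : ℝ) *
        (PowerSeries.X ^ i * (faulhaberPoly (m - i) : PowerSeries ℝ) * P i) -
      PowerSeries.X ^ (m + 1) * ∑ i ∈ Finset.range (m + 1),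
        PowerSeries.C ((m.choose i : ℝ) * (d : ℝ) ^ (m - i)) * P i +
      PowerSeries.C (0 ^ m) * PowerSeries.X) ∧
    (∀ m, D m = ∑ i ∈ Finset.range (m + 1), PowerSeries.C (m.choose i : ℝ) *
        (PowerSeries.X ^ i * (faulhaberPoly (m - i) : PowerSeries ℝ) * D i) -
      PowerSeries.X ^ (m + 1) * ∑ i ∈ Finset.range (m + 1),
        PowerSeries.C ((m.choose i : ℝ) * (d : ℝ) ^ (m - i)) * D i +
      (PowerSeries.C (0 ^ m) * PowerSeries.X - PowerSeries.X ^ (m + 1) *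
        ∑ i ∈ Finset.range (m + 1),
          PowerSeries.C ((m.choose i : ℝ) * (d : ℝ) ^ (m - i)) * P i)) := by
  have hP0 : HasExp (avoidMoment d 0) 1 := by
    refine HasExp.congr' (by simpa using HasExp.const 1) ?_
    filter_upwards [eventually_base d] with b hb using (avoidMoment_zero hb.1 hb.2).symm
  have hD0 : HasExp (diffMoment d 0) 0 := by
    refine HasExp.congr' (by simpa using HasExp.const 0) ?_
    filter_upwards [eventually_base d] with b hb using (diffMoment_zero hb.1 hb.2).symm
  have hq := fun m : ℕ => HasExp.inv.const_mul (0 ^ m)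
  obtain ⟨P, hP, hP'⟩ := exists_hasExp_of_recursion (d : ℝ) (avoidMoment d) _ _ hq ⟨_, hP0⟩
    fun m => (eventually_base d).mono fun b hb => avoidMoment_eq hb.1 hb.2 m
  have hq' := fun m : ℕ => (hq m).sub ((HasExp.inv.pow (m + 1)).mul
    (HasExp.sum (s := Finset.range (m + 1)) fun i _ =>
      (hP i).const_mul ((m.choose i : ℝ) * (d : ℝ) ^ (m - i))))
  obtain ⟨D, hD, hD'⟩ := exists_hasExp_of_recursion (d : ℝ) (diffMoment d) _ _ hq' ⟨_, hD0⟩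
    fun m => (eventually_base d).mono fun b hb => diffMoment_eq hb.1 hb.2 m
  exact ⟨P, D, hP, hD, (hP 0).unique hP0, (hD 0).unique hD0, hP', hD'⟩

/-! ### From expansions of moments to expansions of functionals. -/

/-- Replacing `f` by an approximation of order `b⁻ᴺ` changes a functional by `O(b⁻ᴺ)`. -/
theorem isBigO_functional_sub {C : ℝ} {E : ℕ → (ℝ → ℝ) → ℝ} {f g : ℕ → ℝ → ℝ} {N : ℕ} (K : ℝ)
    (hE : ∀ᶠ b in atTop, BoundedFunctional C (E b)) (hg : ∀ b, ∃ M, BoundedBy M (g b))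
    (h : ∀ᶠ b : ℕ in atTop, ∀ x ∈ Set.Icc (0 : ℝ) 1, |f b x - g b x| ≤ K * (b : ℝ)⁻¹ ^ N) :
    (fun b => E b (f b) - E b (g b)) =O[atTop] fun b : ℕ => (b : ℝ)⁻¹ ^ N := by
  refine IsBigO.of_bound (C * K) ?_
  filter_upwards [hE, h] with b hb h
  rw [Real.norm_eq_abs, Real.norm_of_nonneg (by positivity), mul_assoc]
  exact hb.abs_sub_le (hg b).choose_spec h

/-- The functionals `E b` have mass and moments with asymptotic expansions. -/
structure HasMomentExp (C : ℝ) (E : ℕ → (ℝ → ℝ) → ℝ) (A : ℕ → PowerSeries ℝ) : Prop where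
  bounded : ∀ᶠ b in atTop, BoundedFunctional C (E b)
  moment : ∀ i, HasExp (fun b => E b fun x => x ^ i) (A i)

/-- The moments with respect to `c + x`. -/
noncomputable def shiftMoment (c : ℝ) (A : ℕ → PowerSeries ℝ) (m : ℕ) : PowerSeries ℝ :=
  ∑ i ∈ Finset.range (m + 1), PowerSeries.C ((m.choose i : ℝ) * c ^ (m - i)) * A i

/-- The moments of the Bernoulli polynomials. -/
noncomputable def bernoulliMoment (A : ℕ → PowerSeries ℝ) (m : ℕ) : PowerSeries ℝ :=
  ∑ i ∈ Finset.range (m + 1), PowerSeries.C ((bernoulli (m - i) : ℝ) * m.choose i) * A i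

namespace HasMomentExp

variable {C : ℝ} {E : ℕ → (ℝ → ℝ) → ℝ} {A : ℕ → PowerSeries ℝ}

theorem shift (h : HasMomentExp C E A) (c : ℝ) (m : ℕ) :
    HasExp (fun b => E b fun x => (c + x) ^ m) (shiftMoment c A m) := by
  refine HasExp.congr' (HasExp.sum fun i _ => (h.moment i).const_mul _) ?_
  filter_upwards [h.bounded] with b hb using (hb.map_shift_pow c m).symm

theorem bernoulli (h : HasMomentExp C E A) (m : ℕ) :
    HasExp (fun b => E b (bernoulliFun m)) (bernoulliMoment A m) := by
  refine HasExp.congr' (HasExp.sum fun i _ => (h.moment i).const_mul _) ?_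
  filter_upwards [h.bounded] with b hb
  rw [← hb.map_linear_comb _ _ _ exists_boundedBy_pow']
  congr 1
  funext x
  exact (bernoulliFun_eq_sum m x).symm

theorem prependDigit_mem (d : ℕ) : ∀ᶠ b : ℕ in atTop, ∀ x ∈ Set.Icc (0 : ℝ) 1,
    (d + x) * (b : ℝ)⁻¹ ∈ Set.Icc (0 : ℝ) 1 ∧ (d + x) * (b : ℝ)⁻¹ ≤ (d + 1) * (b : ℝ)⁻¹ := by
  filter_upwards [eventually_gt_atTop d] with b hb x hx
  exact ⟨prepend_mem hb hx, mul_le_mul_of_nonneg_right (by linarith [hx.2]) (by positivity)⟩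

/-- The expansion for a function of `(d + x) / b` with a Taylor expansion at zero. -/
theorem prependDigit_taylor (h : HasMomentExp C E A) (d : ℕ) {f : ℝ → ℝ} (c : ℕ → ℝ) (K : ℕ → ℝ)
    (hf : ∀ N, ∀ y ∈ Set.Icc (0 : ℝ) 1,
      |f y - ∑ i ∈ Finset.range (N + 1), c i * y ^ i| ≤ K N * y ^ (N + 1)) :
    HasExp (fun b => E b (prependDigit b d f)) (PowerSeries.mk fun n =>
      ∑ i ∈ Finset.range (n + 1), (PowerSeries.C (c i) * shiftMoment d A i).coeff (n - i)) := by
  refine HasExp.series (fun i => (h.shift d i).const_mul (c i)) fun N => ?_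
  have hK : 0 ≤ K N := by
    have := (abs_nonneg _).trans (hf N 1 (by simp))
    simpa using this
  -- On the unit interval (d + x)/b ≤ (d + 1)/b, which turns the Taylor remainder at y = (d + x)/b
  -- into this constant times b⁻⁽ᴺ⁺¹⁾.
  have key := isBigO_functional_sub (K N * (d + 1) ^ (N + 1)) (N := N + 1)
    (f := fun b => prependDigit b d f)
    (g := fun (b : ℕ) x => ∑ i ∈ Finset.range (N + 1), ((b : ℝ)⁻¹ ^ i * c i) * ((d : ℝ) + x) ^ i)
    h.bounded (fun b => exists_boundedBy_of_continuousOn (by fun_prop)) (by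
      filter_upwards [prependDigit_mem d] with b hb x hx
      have h1 := hf N _ (hb x hx).1
      have h2 := pow_le_pow_left₀ (hb x hx).1.1 (hb x hx).2 (N + 1)
      rw [mul_pow ((d : ℝ) + 1)] at h2
      rw [prependDigit_apply, mul_assoc]
      refine le_trans (le_of_eq ?_) (h1.trans (mul_le_mul_of_nonneg_left h2 hK))
      congr 2
      refine Finset.sum_congr rfl fun i _ => ?_
      rw [mul_pow]
      ring)
  refine key.congr' ?_ EventuallyEq.rfl
  filter_upwards [h.bounded] with b hb
  rw [hb.map_linear_comb _ _ _ (exists_boundedBy_pow _)]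
  simp only [mul_assoc]

/-- The expansion of `ψ(1 + (d + x) / b) + γ`. -/
theorem digammaSeries (h : HasMomentExp C E A) (d : ℕ) :
    HasExp (fun b => E b (prependDigit b d digammaSeries)) (PowerSeries.mk fun n =>
      ∑ i ∈ Finset.range (n + 1), (PowerSeries.C (if i = 0 then 0 else
        (-1) ^ (i - 1) * (riemannZeta ((i + 1 : ℕ) : ℂ)).re) * shiftMoment d A i).coeff (n - i)) := by
  refine h.prependDigit_taylor d _ (fun _ => (riemannZeta ((2 : ℕ) : ℂ)).re) fun N y hy => ?_
  have := digammaSeries_taylor N hy.1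
  rw [Finset.sum_range_succ']
  simpa [add_assoc, one_add_one_eq_two] using this

/-- The expansion of `1 / (d + (d + x) / b)`. -/
theorem prependDigit_inv (h : HasMomentExp C E A) {d : ℕ} (hd : 0 < d) :
    HasExp (fun b => E b (prependDigit b d fun x => 1 / ((d : ℝ) + x))) (PowerSeries.mk fun n =>
      ∑ i ∈ Finset.range (n + 1), (PowerSeries.C ((-1) ^ i * (d : ℝ)⁻¹ ^ (i + 1)) *
        shiftMoment d A i).coeff (n - i)) := by
  refine h.prependDigit_taylor d _ (fun _ => 1) fun N y hy => ?_
  have hd' : (1 : ℝ) ≤ d := by exact_mod_cast hd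
  have hy0 := hy.1
  rw [inv_add_eq_geom hd hy.1 (N + 1)]
  have : ∑ i ∈ Finset.range (N + 1), (-1) ^ i * (d : ℝ)⁻¹ ^ (i + 1) * y ^ i =
      ∑ i ∈ Finset.range (N + 1), (-1) ^ i * y ^ i * (d : ℝ)⁻¹ ^ (i + 1) :=
    Finset.sum_congr rfl fun i _ => by ring
  rw [this, add_sub_cancel_left, abs_div, abs_mul, abs_mul, abs_pow, abs_neg, abs_one, one_pow,
    one_mul, one_mul, abs_of_nonneg (by positivity), abs_of_nonneg (by positivity),
    abs_of_pos (by positivity)]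
  refine (div_le_self (by positivity) (by linarith)).trans ?_
  exact mul_le_of_le_one_right (by positivity)
    (pow_le_one₀ (by positivity) (inv_le_one_of_one_le₀ hd'))

end HasMomentExp

theorem sum_prependDigit_inv {b d : ℕ} (hb : 0 < b) (x : ℝ) :
    ∑ a ∈ Finset.range b, 1 / ((d : ℝ) + (a + x) * (b : ℝ)⁻¹) =
      b * ∑ n ∈ Finset.Ico (d * b) ((d + 1) * b), 1 / ((n : ℝ) + x) := by
  have hb' : (b : ℝ) ≠ 0 := by positivity
  rw [Finset.sum_Ico_eq_sum_range, add_mul, one_mul, Nat.add_sub_cancel_left, Finset.mul_sum]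
  refine Finset.sum_congr rfl fun a _ => ?_
  have : (d : ℝ) + (a + x) * (b : ℝ)⁻¹ = (((d * b + a : ℕ) : ℝ) + x) * (b : ℝ)⁻¹ := by
    push_cast
    field_simp
    ring
  rw [this, one_div, mul_inv, inv_inv, one_div]
  ring

/-- The expansion of `∑ 1 / (n + x)` over the numbers `n` with two digits and leading digit `d`. -/
theorem meanDiff_sum_prependDigit_inv {d : ℕ} (h0 : 0 < d) {C : ℝ} {D : ℕ → PowerSeries ℝ}
    (h : HasMomentExp C (fun b => meanDiff b d) D) :
    HasExp (fun b => meanDiff b d (∑ a ∈ Finset.range b, prependDigit b a fun x => 1 / ((d : ℝ) + x)))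
      (PowerSeries.mk fun n => ∑ j ∈ Finset.range (n + 1),
        (PowerSeries.C ((-1) ^ j / (j + 1) * (((d : ℝ) + 1)⁻¹ ^ (j + 1) - (d : ℝ)⁻¹ ^ (j + 1))) *
          bernoulliMoment D (j + 1)).coeff (n - j)) := by
  refine HasExp.series (fun j => (h.bernoulli (j + 1)).const_mul
    ((-1) ^ j / (j + 1) * (((d : ℝ) + 1)⁻¹ ^ (j + 1) - (d : ℝ)⁻¹ ^ (j + 1)))) fun N => ?_
  -- One extra order is needed because the sum is multiplied by b.
  obtain ⟨K, hK⟩ := sum_inv_add_sub_digammaApprox (N + 1)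
  have hdb : Tendsto (fun b : ℕ => d * b) atTop atTop := tendsto_id.const_mul_atTop' h0
  have hd' : (1 : ℝ) ≤ d := by exact_mod_cast h0
  set c : ℕ → ℝ := fun j =>
    (-1) ^ j / (j + 1) * (((d : ℝ) + 1)⁻¹ ^ (j + 1) - (d : ℝ)⁻¹ ^ (j + 1)) with hc
  have hcomb : ∀ b : ℕ, Continuous fun x => ∑ j ∈ Finset.range (N + 1),
      ((b : ℝ)⁻¹ ^ j * c j) * bernoulliFun (j + 1) x := fun b =>
    continuous_finsetSum _ fun j _ => continuous_const.mul (continuous_bernoulliFun _)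
  have key := isBigO_functional_sub |K| (N := N + 1)
    (f := fun b => ∑ a ∈ Finset.range b, prependDigit b a fun x => 1 / ((d : ℝ) + x))
    -- The logarithms, of size b, form a multiple of the constant function 1 and disappear under
    -- `meanDiff`.
    (g := fun (b : ℕ) => (b * (Real.log ((d + 1) * b : ℕ) - Real.log (d * b : ℕ))) • (1 : ℝ → ℝ) +
      fun x => ∑ j ∈ Finset.range (N + 1), ((b : ℝ)⁻¹ ^ j * c j) * bernoulliFun (j + 1) x)
    h.bounded (fun b => exists_boundedBy_of_continuousOn
      ((continuous_one.const_smul _).add (hcomb b)).continuousOn) (by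
    filter_upwards [hdb.eventually hK, eventually_gt_atTop 0] with b hb hb0 x hx
    have hbpos : (0 : ℝ) < b := by exact_mod_cast hb0
    have h1 := hb ((d + 1) * b) (Nat.mul_le_mul_right _ (by omega)) x hx
    simp only [Finset.sum_apply, prependDigit_apply, Pi.add_apply, Pi.smul_apply, Pi.one_apply,
      smul_eq_mul, mul_one]
    have e1 : (b : ℝ) * (digammaApprox (N + 1) ((d + 1) * b) x - digammaApprox (N + 1) (d * b) x) =
        b * (Real.log ((d + 1) * b : ℕ) - Real.log (d * b : ℕ)) +
        ∑ j ∈ Finset.range (N + 1), ((b : ℝ)⁻¹ ^ j * c j) * bernoulliFun (j + 1) x := by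
      rw [digammaApprox, digammaApprox, add_sub_add_comm, ← Finset.sum_sub_distrib, mul_add,
        Finset.mul_sum]
      congr 1
      refine Finset.sum_congr rfl fun j _ => ?_
      have e2 : (b : ℝ) * (b : ℝ)⁻¹ = 1 := mul_inv_cancel₀ hbpos.ne'
      push_cast
      rw [mul_inv, mul_inv, mul_pow, mul_pow, pow_succ (b : ℝ)⁻¹ j, hc]
      linear_combination ((-1) ^ j * bernoulliFun (j + 1) x / (j + 1) *
        (((d : ℝ) + 1)⁻¹ ^ (j + 1) - (d : ℝ)⁻¹ ^ (j + 1)) * (b : ℝ)⁻¹ ^ j) * e2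
    rw [sum_prependDigit_inv hb0, ← e1, ← mul_sub, abs_mul, abs_of_pos hbpos]
    have h2 : ((d * b : ℕ) : ℝ)⁻¹ ^ (N + 1 + 1) ≤ (b : ℝ)⁻¹ ^ (N + 1 + 1) := by
      refine pow_le_pow_left₀ (by positivity) (inv_anti₀ hbpos ?_) _
      push_cast
      nlinarith
    refine (mul_le_mul_of_nonneg_left (h1.trans (mul_le_mul (le_abs_self K) h2 (by positivity)
      (abs_nonneg K))) hbpos.le).trans (le_of_eq ?_)
    rw [pow_succ _ (N + 1)]
    field_simp)
  refine key.congr' ?_ EventuallyEq.rfl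
  filter_upwards [h.bounded, eventually_base d] with b hb hb'
  have hB := fun j => exists_boundedBy_of_continuousOn
    (continuous_bernoulliFun (k := j + 1)).continuousOn
  have hone : BoundedBy 1 (1 : ℝ → ℝ) := fun x _ => by simp
  rw [hb.map_add (hone.smul _) (exists_boundedBy_of_continuousOn
    (hcomb b).continuousOn).choose_spec, hb.map_smul,
    meanDiff_one hb'.1 hb'.2, mul_zero, zero_add, hb.map_linear_comb _ _ _ hB]
  simp only [hc, mul_assoc]

/-! ### The expansion of the Irwin sum and its explicit coefficients. -/

/-- The coefficients of the expansion of the Irwin sum, in terms of those of the moments of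
`avoidMean` and `meanDiff`. -/
noncomputable def irwinCoeff (d : ℕ) (P D : ℕ → PowerSeries ℝ) (n : ℕ) : ℝ :=
  (if n = 0 then 1 / (d : ℝ) else 0) -
  ∑ i ∈ Finset.range (n + 1), (if i = 0 then 0 else
    (-1) ^ (i - 1) * (riemannZeta ((i + 1 : ℕ) : ℂ)).re) * (shiftMoment d D i).coeff (n - i) +
  ∑ j ∈ Finset.range (n + 1), (-1) ^ j / (j + 1) *
    (((d : ℝ) + 1)⁻¹ ^ (j + 1) - (d : ℝ)⁻¹ ^ (j + 1)) * (bernoulliMoment D (j + 1)).coeff (n - j) -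
  ∑ i ∈ Finset.range (n + 1), (-1) ^ i * (d : ℝ)⁻¹ ^ (i + 1) *
    ((shiftMoment d D i).coeff (n - i) + (shiftMoment d P i).coeff (n - i))

/-- In `irwinSum_eq` the term b · meanDiff 1/(d + x) is replaced by means of `meanDiff_eq`; this
produces the constant 1/d, the sum over two-digit numbers with leading digit d, and the two
corrections for the excluded digit d. -/
theorem hasExp_irwinSum {d : ℕ} (h0 : 0 < d) {P D : ℕ → PowerSeries ℝ}
    (hP : ∀ m, HasExp (avoidMoment d m) (P m)) (hD : ∀ m, HasExp (diffMoment d m) (D m)) :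
    HasExp (fun b => irwinSum b d 1 - b * Real.log b) (PowerSeries.mk (irwinCoeff d P D)) := by
  have hP' : HasMomentExp 1 (fun b => avoidMean b d) P :=
    ⟨(eventually_base d).mono fun b hb => avoidMean_boundedFunctional hb.1 hb.2, hP⟩
  have hD' : HasMomentExp (1 + 1) (fun b => meanDiff b d) D :=
    ⟨(eventually_base d).mono fun b hb => meanDiff_boundedFunctional hb.1 hb.2, hD⟩
  have h := (((HasExp.const (1 / (d : ℝ))).sub (hD'.digammaSeries d)).add
    (meanDiff_sum_prependDigit_inv h0 hD')).sub
    ((hD'.prependDigit_inv h0).add (hP'.prependDigit_inv h0))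
  convert h.congr' (g := fun b => irwinSum b d 1 - b * Real.log b) ?_ using 1
  · ext n
    rw [map_sub, map_add, map_sub, map_add]
    simp only [PowerSeries.coeff_mk, PowerSeries.coeff_C_mul, PowerSeries.coeff_C]
    rw [irwinCoeff, ← Finset.sum_add_distrib]
    simp only [mul_add]
  filter_upwards [eventually_base d] with b hb
  have hinv := boundedBy_inv (a := (d : ℝ)) (by exact_mod_cast h0)
  have hb' : (b : ℝ) ≠ 0 := by
    have := hb.2
    positivity
  rw [irwinSum_eq h0 hb.1, meanDiff_eq hb.1 hb.2 hinv, mul_inv_cancel_left₀ hb',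
    (meanDiff_boundedFunctional hb.1 hb.2).map_sum fun a ha =>
      ⟨_, hinv.prependDigit (Finset.mem_range.1 ha)⟩, add_zero]
  ring

theorem coeff_faulhaberPoly_mul (n i k : ℕ) (a : ℝ) (A : PowerSeries ℝ) :
    (PowerSeries.C a * (PowerSeries.X ^ i * (faulhaberPoly k : PowerSeries ℝ) * A)).coeff n =
      ∑ r ∈ Finset.range (k + 1), if i + r ≤ n then
        a * ((bernoulli r : ℝ) * (k + 1).choose r / (k + 1)) * A.coeff (n - (i + r)) else 0 := by
  have h : (faulhaberPoly k : PowerSeries ℝ) = ∑ r ∈ Finset.range (k + 1),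
      PowerSeries.C ((bernoulli r : ℝ) * (k + 1).choose r / (k + 1)) * PowerSeries.X ^ r := by
    rw [faulhaberPoly, ← Polynomial.coeToPowerSeries.ringHom_apply, map_sum]
    simp
  rw [h, Finset.mul_sum, Finset.sum_mul, Finset.mul_sum, map_sum]
  refine Finset.sum_congr rfl fun r _ => ?_
  rw [show ∀ c : PowerSeries ℝ, PowerSeries.C a * (PowerSeries.X ^ i *
    (c * PowerSeries.X ^ r) * A) = PowerSeries.C a * (c * (PowerSeries.X ^ (i + r) * A)) from
      fun c => by rw [pow_add]; ring, PowerSeries.coeff_C_mul, PowerSeries.coeff_C_mul,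
    PowerSeries.coeff_X_pow_mul']
  split_ifs <;> ring

theorem coeff_shift_sum (n m : ℕ) (c : ℝ) (P : ℕ → PowerSeries ℝ) :
    (PowerSeries.X ^ (m + 1) * ∑ i ∈ Finset.range (m + 1),
        PowerSeries.C ((m.choose i : ℝ) * c ^ (m - i)) * P i).coeff n =
      if m + 1 ≤ n then ∑ i ∈ Finset.range (m + 1), (m.choose i : ℝ) * c ^ (m - i) *
        (P i).coeff (n - (m + 1)) else 0 := by
  rw [PowerSeries.coeff_X_pow_mul', map_sum]
  simp only [PowerSeries.coeff_C_mul]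

/-- The terms of the recursion for the coefficients of the moments which come from all digits. -/
noncomputable def digitTerms (P : ℕ → PowerSeries ℝ) (m n : ℕ) : ℝ :=
  ∑ i ∈ Finset.range (m + 1), ∑ r ∈ Finset.range (m - i + 1), if i + r ≤ n then
    (m.choose i : ℝ) * ((bernoulli r : ℝ) * (m - i + 1).choose r / ((m - i : ℕ) + 1)) *
      (P i).coeff (n - (i + r)) else 0

/-- The terms of the recursion for the coefficients of the moments which come from the digit `d`. -/
noncomputable def exceptTerms (d : ℕ) (P : ℕ → PowerSeries ℝ) (m n : ℕ) : ℝ :=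
  if m + 1 ≤ n then ∑ i ∈ Finset.range (m + 1), (m.choose i : ℝ) * (d : ℝ) ^ (m - i) *
    (P i).coeff (n - (m + 1)) else 0

theorem bernoulli_three_eq : bernoulli 3 = 0 :=
  bernoulli_eq_zero_of_odd (by decide) (by norm_num)

/-- Every term of the recursion involves either `P 0` or a coefficient of strictly lower order in
b⁻¹, so the values follow successively. Coefficients n of moment m with m + n ≤ 5 suffice for the
first five terms. -/
theorem avoid_coeffs {d : ℕ} {P : ℕ → PowerSeries ℝ} (h0 : P 0 = 1)
    (h : ∀ m, 0 < m → ∀ n, (P m).coeff n = digitTerms P m n - exceptTerms d P m n) :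
    (P 1).coeff 0 = 1 / 2 ∧
    (P 1).coeff 1 = 0 ∧
    (P 1).coeff 2 = -(d : ℝ) - 1 / 2 ∧
    (P 1).coeff 3 = -(d : ℝ) - 1 / 2 ∧
    (P 1).coeff 4 = 0 ∧
    (P 2).coeff 0 = 1 / 3 ∧
    (P 2).coeff 1 = 0 ∧
    (P 2).coeff 2 = 0 ∧
    (P 2).coeff 3 = -(d : ℝ) ^ 2 - 2 * (d : ℝ) - 5 / 6 ∧
    (P 3).coeff 0 = 1 / 4 ∧
    (P 3).coeff 1 = 0 ∧
    (P 3).coeff 2 = 0 ∧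
    (P 4).coeff 0 = 1 / 5 ∧
    (P 4).coeff 1 = 0 ∧
    (P 5).coeff 0 = 1 / 6 := by
  have c10 : (P 1).coeff 0 = 1 / 2 := by
    rw [h 1 (by norm_num) 0]
    simp [digitTerms, exceptTerms, Finset.sum_range_succ, Nat.choose, PowerSeries.coeff_one,
      -PowerSeries.coeff_zero_eq_constantCoeff, h0]
    ring
  have c11 : (P 1).coeff 1 = 0 := by
    rw [h 1 (by norm_num) 1]
    simp [digitTerms, exceptTerms, Finset.sum_range_succ, Nat.choose, PowerSeries.coeff_one,
      -PowerSeries.coeff_zero_eq_constantCoeff, h0, c10]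
    ring
  have c12 : (P 1).coeff 2 = -(d : ℝ) - 1 / 2 := by
    rw [h 1 (by norm_num) 2]
    simp [digitTerms, exceptTerms, Finset.sum_range_succ, Nat.choose, PowerSeries.coeff_one,
      -PowerSeries.coeff_zero_eq_constantCoeff, h0, c10, c11]
    ring
  have c13 : (P 1).coeff 3 = -(d : ℝ) - 1 / 2 := by
    rw [h 1 (by norm_num) 3]
    simp [digitTerms, exceptTerms, Finset.sum_range_succ, Nat.choose, PowerSeries.coeff_one,
      -PowerSeries.coeff_zero_eq_constantCoeff, h0, c11, c12]
  have c14 : (P 1).coeff 4 = 0 := by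
    rw [h 1 (by norm_num) 4]
    simp [digitTerms, exceptTerms, Finset.sum_range_succ, Nat.choose, PowerSeries.coeff_one,
      -PowerSeries.coeff_zero_eq_constantCoeff, h0, c12, c13]
  have c20 : (P 2).coeff 0 = 1 / 3 := by
    rw [h 2 (by norm_num) 0]
    simp [digitTerms, exceptTerms, Finset.sum_range_succ, Nat.choose, PowerSeries.coeff_one,
      -PowerSeries.coeff_zero_eq_constantCoeff, h0]
    ring
  have c21 : (P 2).coeff 1 = 0 := by
    rw [h 2 (by norm_num) 1]
    simp [digitTerms, exceptTerms, Finset.sum_range_succ, Nat.choose, PowerSeries.coeff_one,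
      -PowerSeries.coeff_zero_eq_constantCoeff, h0, c10]
    ring
  have c22 : (P 2).coeff 2 = 0 := by
    rw [h 2 (by norm_num) 2]
    simp [digitTerms, exceptTerms, Finset.sum_range_succ, Nat.choose, bernoulli_two,
      PowerSeries.coeff_one, -PowerSeries.coeff_zero_eq_constantCoeff, h0, c10, c11, c20]
    ring
  have c23 : (P 2).coeff 3 = -(d : ℝ) ^ 2 - 2 * (d : ℝ) - 5 / 6 := by
    rw [h 2 (by norm_num) 3]
    simp [digitTerms, exceptTerms, Finset.sum_range_succ, Nat.choose, bernoulli_two,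
      PowerSeries.coeff_one, -PowerSeries.coeff_zero_eq_constantCoeff, h0, c10, c11, c12, c20, c21]
    ring
  have c30 : (P 3).coeff 0 = 1 / 4 := by
    rw [h 3 (by norm_num) 0]
    simp [digitTerms, exceptTerms, Finset.sum_range_succ, Nat.choose, PowerSeries.coeff_one,
      -PowerSeries.coeff_zero_eq_constantCoeff, h0]
    ring
  have c31 : (P 3).coeff 1 = 0 := by
    rw [h 3 (by norm_num) 1]
    simp [digitTerms, exceptTerms, Finset.sum_range_succ, Nat.choose, PowerSeries.coeff_one,
      -PowerSeries.coeff_zero_eq_constantCoeff, h0, c10]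
    ring
  have c32 : (P 3).coeff 2 = 0 := by
    rw [h 3 (by norm_num) 2]
    simp [digitTerms, exceptTerms, Finset.sum_range_succ, Nat.choose, bernoulli_two,
      PowerSeries.coeff_one, -PowerSeries.coeff_zero_eq_constantCoeff, h0, c10, c11, c20]
    ring
  have c40 : (P 4).coeff 0 = 1 / 5 := by
    rw [h 4 (by norm_num) 0]
    simp [digitTerms, exceptTerms, Finset.sum_range_succ, Nat.choose, PowerSeries.coeff_one,
      -PowerSeries.coeff_zero_eq_constantCoeff, h0]
    ring
  have c41 : (P 4).coeff 1 = 0 := by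
    rw [h 4 (by norm_num) 1]
    simp [digitTerms, exceptTerms, Finset.sum_range_succ, Nat.choose, PowerSeries.coeff_one,
      -PowerSeries.coeff_zero_eq_constantCoeff, h0, c10]
    ring
  have c50 : (P 5).coeff 0 = 1 / 6 := by
    rw [h 5 (by norm_num) 0]
    simp [digitTerms, exceptTerms, Finset.sum_range_succ, Nat.choose, PowerSeries.coeff_one,
      -PowerSeries.coeff_zero_eq_constantCoeff, h0]
    ring
  exact ⟨c10, c11, c12, c13, c14, c20, c21, c22, c23, c30, c31, c32, c40, c41, c50⟩

/-- All moments of `meanDiff` start at b⁻²: `D 0 = 0` removes the terms i = 0, and the source coming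
from `P` has order at least m + 1 ≥ 2. The digamma block pairs moment j + 1 with order n - j, so
here values with m + n ≤ 6 are needed. -/
theorem diff_coeffs {d : ℕ} {P D : ℕ → PowerSeries ℝ} (hP0 : P 0 = 1) (h0 : D 0 = 0)
    (hP : ∀ m, 0 < m → ∀ n, (P m).coeff n = digitTerms P m n - exceptTerms d P m n)
    (h : ∀ m, 0 < m → ∀ n, (D m).coeff n =
      digitTerms D m n - exceptTerms d D m n - exceptTerms d P m n) :
    (∀ m, (D m).coeff 0 = 0) ∧ (∀ m, (D m).coeff 1 = 0) ∧
    (D 1).coeff 2 = -(d : ℝ) - 1 / 2 ∧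
    (D 1).coeff 3 = -(d : ℝ) - 1 / 2 ∧
    (D 1).coeff 4 = (d : ℝ) + 1 / 2 ∧
    (D 1).coeff 5 = 3 * (d : ℝ) + 3 / 2 ∧
    (D 2).coeff 2 = 0 ∧
    (D 2).coeff 3 = -(d : ℝ) ^ 2 - 2 * (d : ℝ) - 5 / 6 ∧
    (D 2).coeff 4 = 0 ∧
    (D 3).coeff 2 = 0 ∧
    (D 3).coeff 3 = -(d : ℝ) - 1 / 2 ∧
    (D 4).coeff 2 = 0 := by
  obtain ⟨p10, p11, p12, p13, p14, p20, p21, p22, p23, p30, p31, p32, p40, p41, p50⟩ := avoid_coeffs hP0 hP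
  have z0 : ∀ m, (D m).coeff 0 = 0 := fun m => by
    rcases Nat.eq_zero_or_pos m with rfl | hm
    · rw [h0, map_zero]
    rw [h m hm 0, exceptTerms, exceptTerms, if_neg (by omega), if_neg (by omega), sub_zero,
      sub_zero, digitTerms]
    refine Finset.sum_eq_zero fun i _ => Finset.sum_eq_zero fun r _ => ?_
    split_ifs with hir
    · obtain rfl : i = 0 := by omega
      rw [h0, map_zero, mul_zero]
    · rfl
  have z1 : ∀ m, (D m).coeff 1 = 0 := fun m => by
    rcases Nat.eq_zero_or_pos m with rfl | hm
    · rw [h0, map_zero]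
    rw [h m hm 1, exceptTerms, exceptTerms, if_neg (by omega), if_neg (by omega), sub_zero,
      sub_zero, digitTerms]
    refine Finset.sum_eq_zero fun i _ => Finset.sum_eq_zero fun r _ => ?_
    split_ifs with hir
    · rcases Nat.eq_zero_or_pos i with rfl | hi
      · rw [h0, map_zero, mul_zero]
      · rw [show 1 - (i + r) = 0 by omega, z0, mul_zero]
    · rfl
  have c12 : (D 1).coeff 2 = -(d : ℝ) - 1 / 2 := by
    rw [h 1 (by norm_num) 2]
    simp [digitTerms, exceptTerms, Finset.sum_range_succ, Nat.choose, PowerSeries.coeff_one,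
      -PowerSeries.coeff_zero_eq_constantCoeff, h0, hP0, z0, z1, p10]
    ring
  have c13 : (D 1).coeff 3 = -(d : ℝ) - 1 / 2 := by
    rw [h 1 (by norm_num) 3]
    simp [digitTerms, exceptTerms, Finset.sum_range_succ, Nat.choose, PowerSeries.coeff_one,
      -PowerSeries.coeff_zero_eq_constantCoeff, h0, hP0, z1, p11, c12]
  have c14 : (D 1).coeff 4 = (d : ℝ) + 1 / 2 := by
    rw [h 1 (by norm_num) 4]
    simp [digitTerms, exceptTerms, Finset.sum_range_succ, Nat.choose, PowerSeries.coeff_one,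
      -PowerSeries.coeff_zero_eq_constantCoeff, h0, hP0, p12, c12, c13]
    ring
  have c15 : (D 1).coeff 5 = 3 * (d : ℝ) + 3 / 2 := by
    rw [h 1 (by norm_num) 5]
    simp [digitTerms, exceptTerms, Finset.sum_range_succ, Nat.choose, PowerSeries.coeff_one,
      -PowerSeries.coeff_zero_eq_constantCoeff, h0, hP0, p13, c13, c14]
    ring
  have c22 : (D 2).coeff 2 = 0 := by
    rw [h 2 (by norm_num) 2]
    simp [digitTerms, exceptTerms, Finset.sum_range_succ, Nat.choose, bernoulli_two,
      -PowerSeries.coeff_zero_eq_constantCoeff, h0, z0, z1]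
  have c23 : (D 2).coeff 3 = -(d : ℝ) ^ 2 - 2 * (d : ℝ) - 5 / 6 := by
    rw [h 2 (by norm_num) 3]
    simp [digitTerms, exceptTerms, Finset.sum_range_succ, Nat.choose, bernoulli_two,
      PowerSeries.coeff_one, -PowerSeries.coeff_zero_eq_constantCoeff, h0, hP0, z0, z1, p10, p20, c12]
    ring
  have c24 : (D 2).coeff 4 = 0 := by
    rw [h 2 (by norm_num) 4]
    simp [digitTerms, exceptTerms, Finset.sum_range_succ, Nat.choose, bernoulli_two,
      PowerSeries.coeff_one, -PowerSeries.coeff_zero_eq_constantCoeff, h0, hP0, z1, p11, p21, c12, c13, c22]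
    ring
  have c32 : (D 3).coeff 2 = 0 := by
    rw [h 3 (by norm_num) 2]
    simp [digitTerms, exceptTerms, Finset.sum_range_succ, Nat.choose,
      -PowerSeries.coeff_zero_eq_constantCoeff, h0, z0, z1]
  have c33 : (D 3).coeff 3 = -(d : ℝ) - 1 / 2 := by
    rw [h 3 (by norm_num) 3]
    simp [digitTerms, exceptTerms, Finset.sum_range_succ, Nat.choose, bernoulli_two, bernoulli_three_eq,
      -PowerSeries.coeff_zero_eq_constantCoeff, h0, z0, z1, c12]
    ring
  have c42 : (D 4).coeff 2 = 0 := by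
    rw [h 4 (by norm_num) 2]
    simp [digitTerms, exceptTerms, Finset.sum_range_succ, Nat.choose,
      -PowerSeries.coeff_zero_eq_constantCoeff, h0, z0, z1]
  exact ⟨z0, z1, c12, c13, c14, c15, c22, c23, c24, c32, c33, c42⟩

theorem coeff_recursions {d : ℕ} {P D : ℕ → PowerSeries ℝ}
    (hP : ∀ m, P m = ∑ i ∈ Finset.range (m + 1), PowerSeries.C (m.choose i : ℝ) *
        (PowerSeries.X ^ i * (faulhaberPoly (m - i) : PowerSeries ℝ) * P i) -
      PowerSeries.X ^ (m + 1) * ∑ i ∈ Finset.range (m + 1),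
        PowerSeries.C ((m.choose i : ℝ) * (d : ℝ) ^ (m - i)) * P i +
      PowerSeries.C (0 ^ m) * PowerSeries.X)
    (hD : ∀ m, D m = ∑ i ∈ Finset.range (m + 1), PowerSeries.C (m.choose i : ℝ) *
        (PowerSeries.X ^ i * (faulhaberPoly (m - i) : PowerSeries ℝ) * D i) -
      PowerSeries.X ^ (m + 1) * ∑ i ∈ Finset.range (m + 1),
        PowerSeries.C ((m.choose i : ℝ) * (d : ℝ) ^ (m - i)) * D i +
      (PowerSeries.C (0 ^ m) * PowerSeries.X - PowerSeries.X ^ (m + 1) *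
        ∑ i ∈ Finset.range (m + 1),
          PowerSeries.C ((m.choose i : ℝ) * (d : ℝ) ^ (m - i)) * P i)) :
    (∀ m, 0 < m → ∀ n, (P m).coeff n = digitTerms P m n - exceptTerms d P m n) ∧
    ∀ m, 0 < m → ∀ n, (D m).coeff n =
      digitTerms D m n - exceptTerms d D m n - exceptTerms d P m n := by
  constructor
  · intro m hm n
    conv_lhs => rw [hP m]
    rw [map_add, map_sub, coeff_shift_sum, map_sum, zero_pow hm.ne', map_zero, zero_mul, map_zero,
      add_zero, digitTerms, exceptTerms]
    simp only [coeff_faulhaberPoly_mul]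
  · intro m hm n
    conv_lhs => rw [hD m]
    rw [map_add, map_sub, map_sub, coeff_shift_sum, coeff_shift_sum, map_sum, zero_pow hm.ne',
      map_zero, zero_mul, map_zero, digitTerms, exceptTerms, exceptTerms]
    simp only [coeff_faulhaberPoly_mul]
    ring

theorem coeff_shiftMoment (c : ℝ) (A : ℕ → PowerSeries ℝ) (m n : ℕ) :
    (shiftMoment c A m).coeff n =
      ∑ i ∈ Finset.range (m + 1), (m.choose i : ℝ) * c ^ (m - i) * (A i).coeff n := by
  simp only [shiftMoment, map_sum, PowerSeries.coeff_C_mul]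

theorem coeff_bernoulliMoment (A : ℕ → PowerSeries ℝ) (m n : ℕ) :
    (bernoulliMoment A m).coeff n =
      ∑ i ∈ Finset.range (m + 1), (bernoulli (m - i) : ℝ) * m.choose i * (A i).coeff n := by
  simp only [bernoulliMoment, map_sum, PowerSeries.coeff_C_mul]

theorem HasExp.isBigO_sum_Icc {f : ℕ → ℝ} {a : ℕ → ℝ} (h : HasExp f (PowerSeries.mk a))
    (h0 : a 0 = 0) (N : ℕ) :
    (fun b : ℕ => f b - ∑ n ∈ Finset.Icc 1 N, a n / (b : ℝ) ^ n) =O[atTop]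
      fun b : ℕ => 1 / (b : ℝ) ^ (N + 1) := by
  refine (h (N + 1)).congr (fun b => ?_) fun b => by rw [inv_pow, one_div]
  rw [HasExp.trunc_eval, Finset.sum_range_succ', PowerSeries.coeff_mk, h0, zero_mul, add_zero,
    Finset.sum_bij (fun (i : ℕ) _ => i + 1) (t := Finset.Icc 1 N)
      (g := fun n => a n / (b : ℝ) ^ n)]
  · intro i hi
    simp only [Finset.mem_Icc, Finset.mem_range] at hi ⊢
    omega
  · intro i _ j _ hij
    omega
  · intro j hj
    have := Finset.mem_Icc.1 hj
    exact ⟨j - 1, Finset.mem_range.2 (by omega), by omega⟩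
  · intro i _
    rw [PowerSeries.coeff_mk, inv_pow, div_eq_mul_inv]

theorem mainTheorem5 (d : ℕ) (hd : 0 < d) :
    (∀ b : ℕ, d < b → Summable (fun m : irwinSet b d 1 => 1 / ((m : ℕ) : ℝ))) ∧
    ∃ a : ℕ → ℝ,
      (∀ N : ℕ,
        (fun b : ℕ => irwinSum b d 1 - (b : ℝ) * Real.log (b : ℝ)
            - ∑ n ∈ Finset.Icc 1 N, a n / (b : ℝ) ^ n)
          =O[atTop] (fun b : ℕ => 1 / (b : ℝ) ^ (N + 1))) ∧
      a 1 = ((d : ℝ) + 1 / 2) / (d : ℝ) ^ 2 ∧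
      a 2 = -(9 * (d : ℝ) ^ 2 + 8 * (d : ℝ) + 2) / (6 * (d : ℝ) ^ 3 * ((d : ℝ) + 1)) ∧
      a 3 = ((d : ℝ) + 1 / 2) * (riemannZeta 2).re
          + ((d : ℝ) + 1 / 2) *
            ((2 * (d : ℝ) ^ 3 + 4 * (d : ℝ) ^ 2 + 4 * (d : ℝ) + 1)
              / (2 * (d : ℝ) ^ 4 * ((d : ℝ) + 1) ^ 2)) ∧
      a 4 = -(2 * (d : ℝ) + 1) * (d : ℝ) * (riemannZeta 3).re
          + ((d : ℝ) + 1 / 2) * (riemannZeta 2).re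
          - (60 * (d : ℝ) ^ 7 + 180 * (d : ℝ) ^ 6 + 350 * (d : ℝ) ^ 5 + 585 * (d : ℝ) ^ 4
              + 597 * (d : ℝ) ^ 3 + 331 * (d : ℝ) ^ 2 + 96 * (d : ℝ) + 12)
            / (60 * (d : ℝ) ^ 5 * ((d : ℝ) + 1) ^ 3) ∧
      a 5 = 3 * ((d : ℝ) + 1 / 2) * (d : ℝ) ^ 2 * (riemannZeta 4).re
          - (3 * (d : ℝ) ^ 2 + 3 * (d : ℝ) + 5 / 6) * (riemannZeta 3).re
          - ((d : ℝ) + 1 / 2) * (riemannZeta 2).re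
          - (12 * (d : ℝ) ^ 8 - 24 * (d : ℝ) ^ 7 - 216 * (d : ℝ) ^ 6 - 387 * (d : ℝ) ^ 5
              - 339 * (d : ℝ) ^ 4 - 186 * (d : ℝ) ^ 3 - 72 * (d : ℝ) ^ 2 - 18 * (d : ℝ) - 2)
            / (12 * (d : ℝ) ^ 6 * ((d : ℝ) + 1) ^ 3) := by
  refine ⟨fun b hb => (hasSum_irwin hd hb).summable, ?_⟩
  obtain ⟨P, D, hP, hD, hP0, hD0, hP', hD'⟩ := exists_moment_expansions d
  obtain ⟨rP, rD⟩ := coeff_recursions hP' hD'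
  obtain ⟨p10, p11, p12, p13, p14, p20, p21, p22, p23, p30, p31, p32, p40, p41, p50⟩ := avoid_coeffs hP0 rP
  obtain ⟨z0, z1, e12, e13, e14, e15, e22, e23, e24, e32, e33, e42⟩ := diff_coeffs hP0 hD0 rP rD
  have hz2 : (1 : ℂ) + 1 = 2 := by norm_num
  have hz3 : (2 : ℂ) + 1 = 3 := by norm_num
  have hz4 : (3 : ℂ) + 1 = 4 := by norm_num
  have hd0 : (d : ℝ) ≠ 0 := by positivity
  have hd1 : (d : ℝ) + 1 ≠ 0 := by positivity
  refine ⟨irwinCoeff d P D, (hasExp_irwinSum hd hP hD).isBigO_sum_Icc ?_, ?_, ?_, ?_, ?_, ?_⟩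
  -- The first of these goals is the vanishing of the coefficient of b⁰: the constant 1/d cancels
  -- against the term i = 0 of `avoidMean`, which has mass one.
  all_goals simp [irwinCoeff, coeff_shiftMoment, coeff_bernoulliMoment, Finset.sum_range_succ,
    Nat.choose, -PowerSeries.coeff_zero_eq_constantCoeff, bernoulli_two, bernoulli_three_eq,
    PowerSeries.coeff_one, hP0, hD0, p10, p11, p12, p13, p14, p20, p21, p22, p23, p30, p31, p32,
    p40, p41, p50, z0, z1, e12, e13, e14, e15, e22, e23, e24, e32, e33, e42,
    hz2, hz3, hz4]
  all_goals field_simp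
  all_goals ring
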